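/- Let $K$ be a field. A $K$-variety is an integral separated $K$-scheme of finite type and of positive dimension; it is $K$-rational if it is birational over $K$ to some projective space $\mathbb{P}^n_K$. For an integral separated $K$-scheme $X$ of finite type, a subset $A\subseteq X(K)$ is thin if there is a $K$-morphism $f:Y\to X$ from a (not necessarily irreducible) reduced separated $K$-scheme $Y$ of finite type such that $A\subseteq f(Y(K))$, the fibre of $f$ over the generic point of $X$ is finite, and $f$ has no rational section; $X$ has the Hilbert Property over $K$ if $X(K)$ is not thin. The field $K$ is Hilbertian if $\mathbb{P}^1_K$ has the Hilbert Property. A cover of a $K$-variety $X$ is a finite surjective $K$-morphism $\phi:Y\to X$ with $Y$ a normal, geometrically integral $K$-variety; its degree is $\deg(\phi)=[K(Y):K(X)]$. A subvariety $C$ of $X$ is a (locally closed, for example closed) subscheme which is a $K$-variety; it has a rational section along $\phi:Y\to X$ if there are a dense open subset $U\subseteq C$ and a morphism $\psi:U\to Y$ such that $\phi\circ\psi$ is the inclusion $U\hookrightarrow X$. **Proposition 4.1.** Let $X$ be a quasi-projective variety over a Hilbertian field $K$. Assume that there exists an infinite set $\mathcal{C}$ of (not necessarily smooth) $K$-rational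 subvarieties of $X$ satisfying the following condition: for every finite family of covers $\phi_i:Y_i\to X$, $i=1,\dots,r$, with $\deg(\phi_i)>1$, there exists a subset $\mathcal{C}'\subseteq\mathcal{C}$ such that $\bigcup_{C\in\mathcal{C}'}C$ is Zariski dense in $X$ and such that for all $C\in\mathcal{C}'$ and all $i=1,\dots,r$, $C$ does not have a rational section along $\phi_i$. Then $X$ has the Hilbert Property over $K$. -/

import Mathlib

open CategoryTheory AlgebraicGeometry

universe u

noncomputable section

namespace HilbertProperty

attribute [local instance] MvPolynomial.gradedAlgebra

/-- Projective `n`-space over a field `K`: `Proj K[x₀, …, xₙ]`. -/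
def projectiveSpace (n : ℕ) (K : Type u) [Field K] : Scheme.{u} :=
  Proj (MvPolynomial.homogeneousSubmodule (Fin (n + 1)) K)

/-- The structure morphism `ℙⁿ_K ⟶ Spec K`. -/
def projectiveSpaceStr (n : ℕ) (K : Type u) [Field K] :
    projectiveSpace n K ⟶ Spec (.of K) :=
  Proj.toSpecZero (MvPolynomial.homogeneousSubmodule (Fin (n + 1)) K) ≫
    Spec.map (CommRingCat.ofHom
      (algebraMap K (MvPolynomial.homogeneousSubmodule (Fin (n + 1)) K 0)))

variable {K : Type u} [Field K]

/-! ### Rational points, rational sections and thin sets -/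

/-- The set `X(K)` of `K`-rational points of a `K`-scheme `X` with structure morphism `s`:
the sections of `s`. -/
def RationalPoints {X : Scheme.{u}} (s : X ⟶ Spec (.of K)) : Type u :=
  {x : Spec (.of K) ⟶ X // x ≫ s = 𝟙 _}

/-- The point of `X(K)` lying under a `K`-point of `Y`, for a `K`-morphism `f : Y ⟶ X`. -/
def RationalPoints.map {X Y : Scheme.{u}} (s : X ⟶ Spec (.of K)) (f : Y ⟶ X)
    (y : RationalPoints (f ≫ s)) : RationalPoints s :=
  ⟨y.1 ≫ f, by rw [Category.assoc]; exact y.2⟩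

/-- A subscheme `i : C ⟶ X` has a rational section along `φ : Y ⟶ X` if there are a dense open
subset `U` of `C` and a morphism `ψ : U ⟶ Y` such that `φ ∘ ψ` is the inclusion of `U` in `X`. -/
def HasRationalSectionAlong {X Y C : Scheme.{u}} (i : C ⟶ X) (φ : Y ⟶ X) : Prop :=
  ∃ ψ : C.PartialMap Y, ψ.hom ≫ φ = ψ.domain.ι ≫ i

/-- A morphism `f : Y ⟶ X` has a rational section if there are a dense open subset `U` of `X` and a
morphism `ψ : U ⟶ Y` such that `f ∘ ψ` is the inclusion of `U` in `X`. -/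
def HasRationalSection {X Y : Scheme.{u}} (f : Y ⟶ X) : Prop :=
  ∃ ψ : X.PartialMap Y, ψ.hom ≫ f = ψ.domain.ι

/-- A set `A ⊆ X(K)` of rational points of an integral `K`-scheme `X` is thin if there is a
`K`-morphism `f : Y ⟶ X` from a (not necessarily irreducible) reduced separated `K`-scheme `Y` of
finite type such that `A ⊆ f(Y(K))`, the fibre of `f` over the generic point of `X` is finite, and
`f` has no rational section. The `K`-structure of `Y` is the one for which `f` is a `K`-morphism. -/
def IsThin {X : Scheme.{u}} (s : X ⟶ Spec (.of K)) (A : Set (RationalPoints s)) : Prop :=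
  ∃ (Y : Scheme.{u}) (f : Y ⟶ X),
    IsReduced Y ∧ IsSeparated (f ≫ s) ∧ LocallyOfFiniteType (f ≫ s) ∧ QuasiCompact (f ≫ s) ∧
    A ⊆ Set.range (RationalPoints.map s f) ∧
    (∀ η : X, IsGenericPoint η Set.univ → IsFinite (f.fiberToSpecResidueField η)) ∧
    ¬ HasRationalSection f

/-- `X` has the Hilbert Property over `K` if `X(K)` is not thin. -/
def HasHilbertProperty {X : Scheme.{u}} (s : X ⟶ Spec (.of K)) : Prop :=
  ¬ IsThin s Set.univ

/-- A field is Hilbertian if the projective line over it has the Hilbert Property. -/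
def IsHilbertian (K : Type u) [Field K] : Prop :=
  HasHilbertProperty (projectiveSpaceStr 1 K)

/-! ### Varieties -/

/-- The morphism `s : X ⟶ Spec K` makes `X` a `K`-variety: an integral separated `K`-scheme of
finite type and of positive dimension. -/
structure IsVariety {X : Scheme.{u}} (s : X ⟶ Spec (.of K)) : Prop where
  isIntegral : IsIntegral X
  isSeparated : IsSeparated s
  locallyOfFiniteType : LocallyOfFiniteType s
  quasiCompact : QuasiCompact s
  dim_pos : 0 < topologicalKrullDim X

/-- A `K`-variety. -/
structure Variety (K : Type u) [Field K] where
  /-- the underlying scheme -/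
  carrier : Scheme.{u}
  /-- the structure morphism -/
  str : carrier ⟶ Spec (.of K)
  isVariety : IsVariety str

instance (X : Variety K) : IsIntegral X.carrier := X.isVariety.isIntegral

/-- A `K`-variety is quasi-projective if it admits an immersion over `K` in some `ℙⁿ_K`. -/
def Variety.IsQuasiProjective (X : Variety K) : Prop :=
  ∃ (n : ℕ) (i : X.carrier ⟶ projectiveSpace n K),
    IsImmersion i ∧ i ≫ projectiveSpaceStr n K = X.str

/-- `X` is `K`-rational: it is birational over `K` to some `ℙⁿ_K`. -/
def Variety.IsRational (X : Variety K) : Prop :=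
  ∃ n : ℕ, Scheme.BirationalOver X.str (projectiveSpaceStr n K)

/-- A subvariety of `X`: a (locally closed) subscheme of `X` that is a `K`-variety. -/
structure Subvariety (X : Variety K) where
  /-- the subvariety, as a subobject of the scheme `X` -/
  subobject : Subobject X.carrier
  isImmersion : IsImmersion subobject.arrow
  isVariety : IsVariety (subobject.arrow ≫ X.str)

/-- A subvariety as a variety in its own right. -/
def Subvariety.toVariety {X : Variety K} (C : Subvariety X) : Variety K where
  carrier := (C.subobject : Scheme.{u})
  str := C.subobject.arrow ≫ X.str
  isVariety := C.isVariety

/-- The inclusion of a subvariety. -/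
def Subvariety.ι {X : Variety K} (C : Subvariety X) : C.toVariety.carrier ⟶ X.carrier :=
  C.subobject.arrow

/-! ### Covers -/

/-- A scheme is normal if all its local rings are integrally closed domains. -/
def IsNormal (X : Scheme.{u}) : Prop :=
  ∀ x : X, IsDomain (X.presheaf.stalk x) ∧ IsIntegrallyClosed (X.presheaf.stalk x)

/-- A cover of a `K`-variety `X`: a finite surjective `K`-morphism `Y ⟶ X` from a normal and
geometrically integral `K`-variety `Y`. -/
structure Cover (X : Variety K) where
  /-- the source `Y` of the cover -/
  source : Variety K
  /-- the morphism `Y ⟶ X` -/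
  hom : source.carrier ⟶ X.carrier
  hom_str : hom ≫ X.str = source.str
  isFinite : IsFinite hom
  surjective : Surjective hom
  isNormal : IsNormal source.carrier
  geometricallyIntegral : GeometricallyIntegral source.str

/-- A dominant morphism of integral schemes maps the generic point to the generic point. -/
theorem map_genericPoint {X Y : Scheme.{u}} [IsIntegral X] [IsIntegral Y] (f : Y ⟶ X)
    [IsDominant f] : f (genericPoint Y) = genericPoint X := by
  have h := (genericPoint_spec Y).image f.continuous
  rw [Set.image_univ, f.denseRange.closure_range] at h
  exact h.eq (genericPoint_spec X)

/-- The pullback map `K(X) ⟶ K(Y)` on function fields of a dominant morphism `f : Y ⟶ X` of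
integral schemes. -/
def functionFieldMap {X Y : Scheme.{u}} [IsIntegral X] [IsIntegral Y] (f : Y ⟶ X)
    [IsDominant f] : X.functionField ⟶ Y.functionField :=
  X.presheaf.stalkSpecializes (specializes_of_eq (map_genericPoint f)) ≫
    f.stalkMap (genericPoint Y)

/-- The degree `[K(Y) : K(X)]` of a cover `Y ⟶ X`. -/
def Cover.degree {X : Variety K} (φ : Cover X) : ℕ :=
  haveI := φ.surjective
  letI : Algebra X.carrier.functionField φ.source.carrier.functionField :=
    (functionFieldMap φ.hom).hom.toAlgebra
  Module.finrank X.carrier.functionField φ.source.carrier.functionField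

end HilbertProperty

end

/-!
Suppose that `X(K)` is thin, by a morphism `f : Y ⟶ X`, and let `U = Spec A` be an affine open subset
of `X`. Over `U` the scheme `Y` is a finite union of integral affine schemes `Spec D`. Those that do
not dominate `U`, and those whose `K`-points are not dense, account only for points of a proper
closed subset of `U`. For each of the others the function field `L = Frac D` is finite over `K(X)`,
because the generic fibre of `f` is finite; it is not `K(X)` itself, because `f` has no rational
section; and it is regular over `K`, because `Spec D` has dense `K`-points
(`isDomain_fractionField_tensorProduct`). So the normalization of `X` in `L` is a cover of degree
`[L : K(X)] > 1` (`exists_cover`), and the `K`-points of `U` that lift to `Spec D` lift to it, again up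
to a proper closed subset (`exists_regular_extension`). In total, the `K`-points of a nonempty open
subset of `U` lift to finitely many covers `φᵢ` of degree greater than one
(`isCovered_rationalPoints`).

The hypothesis applied to the `φᵢ` gives a rational subvariety `C` that meets this open subset and has
no rational section along any `φᵢ`. Every nonempty open subset of `C` contains a principal open subset
of an affine space, and these have the Hilbert property, as `K` is Hilbertian. The pullbacks of the `φᵢ` to
it are finite and have no rational section; hence it has a `K`-point that lifts to none of the `φᵢ`
(`exists_point_of_subvariety`), which is a contradiction.

The Hilbert property of an affine scheme enters in the form of `AlgHP`, about algebras finite over its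
coordinate ring. The Hilbert property of `ℙ¹` gives that of the affine line
(`AlgHP.of_hasHilbertProperty`), and it passes from `A` to `A[X]` (`AlgHP.polynomial`): the Weil
restriction along `A → A[X]` of a finite `A[X]`-algebra `B` is, as far as points in domains are
concerned, a finite `A`-algebra `W`, so a `K`-point `a` of `A` that does not lift to `W` can be chosen,
and over the line `a × 𝔸¹` the algebra `B` still has no section. Finiteness of normalization is proved
for all fields `K`, perfect or not (`finite_integralClosure`).
-/

noncomputable section

namespace HilbertProperty

/-! ### The Hilbert property of a domain -/

/-- The Hilbert property of a domain `A` over a field `K`, stated with finite `A`-algebras: whenever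
`B` is finite over `A` and `Spec B → Spec A` has no rational section, some `K`-point of `Spec A` does
not lift to a `K`-point of `Spec B`. -/
def AlgHP (K A : Type u) [Field K] [CommRing A] [IsDomain A] [Algebra K A] : Prop :=
  ∀ (B : Type u) [CommRing B] [Algebra A B] [Module.Finite A B],
    IsEmpty (B →ₐ[A] FractionRing A) →
    ∃ a : A →ₐ[K] K, ∀ b : B →+* K, b.comp (algebraMap A B) ≠ a

/-! ### Weil restriction along `A → A[X]` -/

section WeilRestriction

open Polynomial

/-- A root in `S[X]` of a monic polynomial over `S[X]` has degree at most the largest degree of a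
coefficient: otherwise the leading term has larger degree than all others. -/
theorem natDegree_le_of_monic_eval_eq_zero {S : Type*} [CommRing S] [IsDomain S] {f : S[X][X]}
    (hf : f.Monic) {D : ℕ} (hD : ∀ k, (f.coeff k).natDegree ≤ D) {p : S[X]} (hp : f.eval p = 0) :
    p.natDegree ≤ D := by
  by_contra! h
  have hn : f.natDegree ≠ 0 := by
    intro h0
    rw [hf.natDegree_eq_zero.mp h0] at hp
    simp at hp
  have hp0 : p ≠ 0 := by rintro rfl; simp at h
  rw [eval_eq_sum_range, Finset.sum_range_succ, hf.coeff_natDegree, one_mul] at hp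
  have h1 : (∑ i ∈ Finset.range f.natDegree, f.coeff i * p ^ i).natDegree ≤
      D + (f.natDegree - 1) * p.natDegree := by
    refine natDegree_sum_le_of_forall_le _ _ fun i hi ↦ ?_
    refine natDegree_mul_le.trans (add_le_add (hD i) (natDegree_pow_le.trans ?_))
    exact Nat.mul_le_mul_right _ (by have := Finset.mem_range.mp hi; omega)
  have h2 : (p ^ f.natDegree).natDegree = f.natDegree * p.natDegree := natDegree_pow _ _
  rw [eq_neg_of_add_eq_zero_right hp, natDegree_neg] at h2
  obtain ⟨n, hn'⟩ := Nat.exists_eq_succ_of_ne_zero hn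
  rw [h2, hn', Nat.succ_sub_one, Nat.succ_mul] at h1
  omega

/-- Roots in `S[X]` of elements integral over `A[X]` have bounded degree, uniformly in the domain
`S` over `A`. -/
theorem exists_natDegree_bound {A B : Type*} [CommRing A] [CommRing B] [Algebra A[X] B] {x : B}
    (hx : IsIntegral A[X] x) : ∃ D : ℕ, ∀ (S : Type u) [CommRing S] [IsDomain S] (s : A →+* S)
      (β : B →+* S[X]), β.comp (algebraMap A[X] B) = mapRingHom s → (β x).natDegree ≤ D := by
  obtain ⟨f, hf, hfx⟩ := hx
  refine ⟨f.support.sup fun k ↦ (f.coeff k).natDegree, fun S _ _ s β hβ ↦ ?_⟩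
  refine natDegree_le_of_monic_eval_eq_zero (hf.map (mapRingHom s)) (fun k ↦ ?_) ?_
  · rw [coeff_map]
    by_cases hk : f.coeff k = 0
    · simp [hk]
    · exact (natDegree_map_le).trans
        (Finset.le_sup (f := fun k ↦ (f.coeff k).natDegree) (mem_support_iff.mpr hk))
  · rw [Polynomial.eval_map, ← hβ, ← hom_eval₂, hfx, map_zero]

/-- The Weil restriction along `A → A[X]` of a finite `A[X]`-algebra `B`: a finite `A`-algebra `W`
with a universal `A[X]`-morphism `B → W[X]`. Only the points of `W` in domains are described. -/
theorem exists_weilRestriction (A B : Type u) [CommRing A] [CommRing B] [Algebra A[X] B]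
    [Module.Finite A[X] B] :
    ∃ (W : Type u) (_ : CommRing W) (_ : Algebra A W), Module.Finite A W ∧
      (∃ w : B →+* W[X], w.comp (algebraMap A[X] B) = mapRingHom (algebraMap A W)) ∧
      ∀ (S : Type u) [CommRing S] [IsDomain S] (s : A →+* S) (β : B →+* S[X]),
        β.comp (algebraMap A[X] B) = mapRingHom s → ∃ ω : W →+* S, ω.comp (algebraMap A W) = s := by
  obtain ⟨m, π, hπ⟩ := Algebra.FiniteType.iff_quotient_mvPolynomial''.mp
    (inferInstance : Algebra.FiniteType A[X] B)
  choose D hD using fun i : Fin m ↦ exists_natDegree_bound.{u} (A := A)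
    (Algebra.IsIntegral.isIntegral (R := A[X]) (π (MvPolynomial.X i)))
  set d : ℕ := Finset.univ.sup D
  let M := MvPolynomial (Fin m × Fin (d + 1)) A
  -- the image of the `i`-th generator is a polynomial of degree at most `d` with unknown coefficients
  let P (i : Fin m) : M[X] := ∑ j : Fin (d + 1), monomial (j : ℕ) (MvPolynomial.X (i, j))
  let ev : MvPolynomial (Fin m) A[X] →+* M[X] :=
    MvPolynomial.eval₂Hom (mapRingHom (algebraMap A M)) P
  -- the conditions on the unknown coefficients expressing that all relations of `B` are respected
  let I : Ideal M := Ideal.span {c | ∃ q, π q = 0 ∧ ∃ n, c = (ev q).coeff n}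
  let W := M ⧸ I
  let ev' : MvPolynomial (Fin m) A[X] →+* W[X] := (mapRingHom (Ideal.Quotient.mk I)).comp ev
  have hker : ∀ q, π q = 0 → ev' q = 0 := fun q hq ↦ by
    ext n
    simp only [ev', RingHom.comp_apply, coe_mapRingHom, coeff_map, coeff_zero]
    exact Ideal.Quotient.eq_zero_iff_mem.mpr (Ideal.subset_span ⟨q, hq, n, rfl⟩)
  let w : B →+* W[X] := RingHom.liftOfSurjective (π : MvPolynomial (Fin m) A[X] →+* B) hπ
    ⟨ev', fun q hq ↦ hker q hq⟩
  have hw : ∀ q, w (π q) = ev' q := fun q ↦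
    RingHom.liftOfRightInverse_comp_apply _ _ _ ⟨ev', fun q hq ↦ hker q hq⟩ q
  have hwA : w.comp (algebraMap A[X] B) = mapRingHom (algebraMap A W) := by
    refine RingHom.ext fun x ↦ ?_
    rw [RingHom.comp_apply, ← π.commutes, hw]
    simp only [ev', ev, RingHom.comp_apply, MvPolynomial.algebraMap_eq, MvPolynomial.coe_eval₂Hom,
      MvPolynomial.eval₂_C, coe_mapRingHom, Polynomial.map_map]
    rfl
  have hP (i : Fin m) : w (π (MvPolynomial.X i)) = (P i).map (Ideal.Quotient.mk I) := by
    rw [hw]; simp [ev', ev]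
  have hPcoeff (i : Fin m) (j : Fin (d + 1)) : (P i).coeff j = MvPolynomial.X (i, j) := by
    simp only [P, finsetSum_coeff, coeff_monomial, Fin.val_inj]
    simp
  refine ⟨W, inferInstance, inferInstance, ?_, ⟨w, hwA⟩, ?_⟩
  · have hint : ∀ x : Fin m × Fin (d + 1),
        IsIntegral A (Ideal.Quotient.mk I (MvPolynomial.X x)) := by
      -- the coefficients of an element of `W[X]` integral over `A[X]` are integral over `A`
      rintro ⟨i, j⟩
      have h1 : IsIntegral A[X] (π (MvPolynomial.X i)) := Algebra.IsIntegral.isIntegral _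
      have h2 : (mapRingHom (algebraMap A W)).IsIntegralElem (w (π (MvPolynomial.X i))) := by
        rw [← hwA]; exact RingHom.IsIntegralElem.map h1 w
      have h3 := (Polynomial.isIntegral_iff_isIntegral_coeff (R := A) (S := W)).mp h2 j
      rwa [hP, coeff_map, hPcoeff] at h3
    have : Algebra.IsIntegral A W := by
      refine ⟨fun x ↦ ?_⟩
      obtain ⟨x, rfl⟩ := Ideal.Quotient.mk_surjective x
      induction x using MvPolynomial.induction_on with
      | C a => exact isIntegral_algebraMap (R := A) (A := W) (x := a)
      | add p q hp hq => rw [map_add]; exact hp.add hq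
      | mul_X p i hp => rw [map_mul]; exact hp.mul (hint i)
    exact Algebra.IsIntegral.finite
  · intro S _ _ s β hβ
    have hdeg (i : Fin m) : (β (π (MvPolynomial.X i))).natDegree < d + 1 :=
      Nat.lt_succ_of_le ((hD i S s β hβ).trans (Finset.le_sup (Finset.mem_univ i)))
    let ω₀ : M →+* S := MvPolynomial.eval₂Hom s fun x ↦ (β (π (MvPolynomial.X x.1))).coeff x.2
    have hω₀ : (mapRingHom ω₀).comp ev = β.comp (π : MvPolynomial (Fin m) A[X] →+* B) := by
      refine MvPolynomial.ringHom_ext' ?_ fun i ↦ ?_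
      · have : (β.comp (π : MvPolynomial (Fin m) A[X] →+* B)).comp MvPolynomial.C =
            mapRingHom s := by
          rw [← hβ]; ext x <;> simp
        rw [this]
        ext x
        · simp [ev, ω₀, M]
        · simp [ev, ω₀]
      · simp only [ev, P, RingHom.comp_apply, MvPolynomial.coe_eval₂Hom, MvPolynomial.eval₂_X,
          map_sum, coe_mapRingHom, map_monomial, ω₀]
        rw [Finset.sum_fin_eq_sum_range]
        conv_rhs => rw [RingHom.coe_coe, as_sum_range' _ _ (hdeg i)]
        refine Finset.sum_congr rfl fun k hk ↦ ?_
        rw [dif_pos (Finset.mem_range.mp hk), MvPolynomial.coe_eval₂Hom, MvPolynomial.eval₂_X]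
    have hI : ∀ x ∈ I, ω₀ x = 0 := by
      intro x hx
      have : I ≤ RingHom.ker ω₀ := by
        refine Ideal.span_le.mpr ?_
        rintro _ ⟨q, hq, n, rfl⟩
        have := congr(($hω₀ q).coeff n)
        simpa [hq] using this
      exact this hx
    refine ⟨Ideal.Quotient.lift I ω₀ hI, RingHom.ext fun x ↦ ?_⟩
    have : algebraMap A W x = Ideal.Quotient.mk I (MvPolynomial.C x) := rfl
    rw [RingHom.comp_apply, this, Ideal.Quotient.lift_mk]
    exact MvPolynomial.eval₂_C _ _ _

end WeilRestriction

/-! ### Permanence of the Hilbert property of a domain -/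

section Permanence

variable {K A : Type u} [Field K] [CommRing A] [IsDomain A] [Algebra K A]

theorem AlgHP.exists_of_isFractionRing (h : AlgHP K A) (F : Type u) [Field F] [Algebra A F]
    [IsFractionRing A F] (B : Type u) [CommRing B] [Algebra A B] [Module.Finite A B]
    (hB : IsEmpty (B →ₐ[A] F)) :
    ∃ a : A →ₐ[K] K, ∀ b : B →+* K, b.comp (algebraMap A B) ≠ a :=
  h B ⟨fun φ ↦ hB.false ((FractionRing.algEquiv A F).toAlgHom.comp φ)⟩

theorem AlgHP.of_algEquiv {A' : Type u} [CommRing A'] [IsDomain A'] [Algebra K A']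
    (h : AlgHP K A) (e : A ≃ₐ[K] A') : AlgHP K A' := by
  intro B _ _ _ hB
  let : Algebra A B := ((algebraMap A' B).comp (e : A →+* A')).toAlgebra
  let : Algebra A A' := (e : A →+* A').toAlgebra
  have : IsScalarTower A A' B := .of_algebraMap_eq' rfl
  have : Module.Finite A A' := .of_surjective (Algebra.linearMap A A') e.surjective
  have : Module.Finite A B := .trans A' B
  have : IsFractionRing A (FractionRing A') := by
    have hinj : Function.Injective (algebraMap A (FractionRing A')) := by
      rw [IsScalarTower.algebraMap_eq A A' (FractionRing A')]
      exact (IsFractionRing.injective A' _).comp e.injective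
    have : FaithfulSMul A (FractionRing A') := (faithfulSMul_iff_algebraMap_injective _ _).mpr hinj
    refine IsFractionRing.of_field A (FractionRing A') fun z ↦ ?_
    obtain ⟨x, y, -, rfl⟩ := IsFractionRing.div_surjective (A := A') z
    refine ⟨e.symm x, e.symm y, ?_⟩
    rw [IsScalarTower.algebraMap_apply A A', IsScalarTower.algebraMap_apply A A']
    exact congrArg₂ (algebraMap A' (FractionRing A') · / algebraMap A' _ ·)
      (e.apply_symm_apply x).symm (e.apply_symm_apply y).symm
  obtain ⟨a, ha⟩ := h.exists_of_isFractionRing (FractionRing A') B ⟨fun φ ↦ hB.false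
    { φ.toRingHom with
      commutes' := fun x ↦ by
        obtain ⟨x, rfl⟩ := e.surjective x
        refine (φ.commutes x).trans ?_
        rw [IsScalarTower.algebraMap_apply A A' (FractionRing A')]
        rfl }⟩
  refine ⟨a.comp e.symm.toAlgHom, fun b hb ↦ ha b ?_⟩
  ext x
  have := congr($hb (e x))
  simpa using! this

/-- The `K`-point in the Hilbert property can be chosen outside a hypersurface `g = 0`: apply the
property to `B × A ⧸ (g)`, to which all points of the hypersurface lift. -/
theorem AlgHP.exists_ne_zero (h : AlgHP K A) {g : A} (hg : g ≠ 0) (B : Type u) [CommRing B]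
    [Algebra A B] [Module.Finite A B] (hB : IsEmpty (B →ₐ[A] FractionRing A)) :
    ∃ a : A →ₐ[K] K, a g ≠ 0 ∧ ∀ b : B →+* K, b.comp (algebraMap A B) ≠ a := by
  suffices hE : IsEmpty (B × (A ⧸ Ideal.span {g}) →ₐ[A] FractionRing A) by
    obtain ⟨a, ha⟩ := h (B × (A ⧸ Ideal.span {g})) hE
    refine ⟨a, fun hag ↦ ?_, fun b hb ↦ ?_⟩
    · refine ha ((Ideal.Quotient.lift (Ideal.span {g}) (a : A →+* K) fun x hx ↦ ?_).comp
        (RingHom.snd _ _)) (RingHom.ext fun x ↦ rfl)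
      obtain ⟨y, rfl⟩ := Ideal.mem_span_singleton.mp hx
      simp [hag]
    · exact ha (b.comp (RingHom.fst _ _)) (by rw [← hb]; rfl)
  · refine ⟨fun φ ↦ ?_⟩
    have h0 : φ (0, 1) = 0 := by
      have h1 : g • ((0, 1) : B × (A ⧸ Ideal.span {g})) = 0 := by
        ext
        · simp
        · simp [Algebra.smul_def]
      have h2 := congr(φ $h1)
      rw [map_smul, map_zero, smul_eq_zero] at h2
      exact h2.resolve_left hg
    have h1 : φ (1, 0) = 1 := by
      have : φ ((1, 0) + (0, 1)) = 1 := by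
        rw [Prod.mk_add_mk, add_zero, zero_add]
        exact map_one φ
      rwa [map_add, h0, add_zero] at this
    exact hB.false <| AlgHom.ofLinearMap (φ.toLinearMap ∘ₗ LinearMap.inl A B _) h1
      fun x y ↦ by simp [← map_mul]

/-- The Hilbert property for finitely many finite algebras at once: apply the property to their
product, whose morphisms to a domain factor through one of the factors. -/
theorem AlgHP.exists_forall (h : AlgHP K A) {ι : Type} [Finite ι] (B : ι → Type u)
    [∀ i, CommRing (B i)] [∀ i, Algebra A (B i)] [∀ i, Module.Finite A (B i)]
    (hB : ∀ i, IsEmpty (B i →ₐ[A] FractionRing A)) :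
    ∃ a : A →ₐ[K] K, ∀ i, ∀ b : B i →+* K, b.comp (algebraMap A (B i)) ≠ a := by
  classical
  cases nonempty_fintype ι
  suffices hE : IsEmpty ((∀ i, B i) →ₐ[A] FractionRing A) by
    obtain ⟨a, ha⟩ := h (∀ i, B i) hE
    exact ⟨a, fun i b hb ↦ ha (b.comp (Pi.evalRingHom B i)) (by rw [← hb]; rfl)⟩
  · refine ⟨fun φ ↦ ?_⟩
    have h1 : ∑ i, φ (Pi.single i 1) = 1 := by
      rw [← map_sum, ← map_one φ]
      congr 1
      exact Finset.univ_sum_single (1 : ∀ i, B i)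
    obtain ⟨i, hi⟩ : ∃ i, φ (Pi.single i 1) ≠ 0 := by
      by_contra! hcon
      simp [hcon] at h1
    have h2 : φ (Pi.single i 1) = 1 := by
      have : φ (Pi.single i 1) * φ (Pi.single i 1) = φ (Pi.single i 1) := by
        rw [← map_mul, ← Pi.single_mul, one_mul]
      exact (mul_eq_left₀ hi).mp this
    refine (hB i).false <| AlgHom.ofLinearMap (φ.toLinearMap ∘ₗ LinearMap.single A B i) h2
      fun x y ↦ ?_
    simp only [LinearMap.comp_apply, LinearMap.coe_single, AlgHom.toLinearMap_apply, Pi.single_mul,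
      map_mul]

open Polynomial in
/-- The Hilbert property passes from `A` and `K[X]` to `A[X]`. A point `a` of `A` that does not lift to
the Weil restriction of `B` is a line `Spec K[X]` in `Spec A[X]` over which `B` has no section. -/
theorem AlgHP.polynomial [IsIntegrallyClosed A] (h : AlgHP K A) (h1 : AlgHP K K[X]) :
    AlgHP K A[X] := by
  intro B _ _ _ hB
  obtain ⟨W, _, _, _, ⟨w, hw⟩, hW⟩ := exists_weilRestriction A B
  have hWE : IsEmpty (W →ₐ[A] FractionRing A) := by
    refine ⟨fun φ ↦ ?_⟩
    -- a point of `W` in `Frac A` is a point of `B` in `(Frac A)[X]`, a subring of `Frac A[X]`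
    let F := FractionRing A
    let Q := FractionRing A[X]
    have hinj : Function.Injective ((algebraMap A[X] Q).comp C) :=
      (IsFractionRing.injective A[X] Q).comp C_injective
    let j : F[X] →+* Q := eval₂RingHom (IsFractionRing.lift (A := A) (K := F) hinj)
      (algebraMap A[X] Q X)
    let β : B →+* Q := (j.comp (mapRingHom (φ : W →+* F))).comp w
    have hβ : β.comp (algebraMap A[X] B) = algebraMap A[X] Q := by
      rw [RingHom.comp_assoc, hw, RingHom.comp_assoc, mapRingHom_comp]
      have : (φ : W →+* F).comp (algebraMap A W) = algebraMap A F := φ.comp_algebraMap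
      rw [this]
      refine Polynomial.ringHom_ext (fun x ↦ ?_) ?_
      · simp [j]
      · simp [j]
    exact hB.false { β with commutes' := fun x ↦ congr($hβ x) }
  obtain ⟨a, ha⟩ := h W hWE
  let s : A[X] →+* K[X] := mapRingHom (a : A →+* K)
  let : Algebra A[X] K[X] := s.toAlgebra
  let Ba := TensorProduct A[X] K[X] B
  have hBaE : IsEmpty (Ba →ₐ[K[X]] FractionRing K[X]) := by
    refine ⟨fun φ ↦ ?_⟩
    -- `K[X]` is integrally closed, so the section has values in `K[X]`
    let F := FractionRing K[X]
    let ψ : B →+* F := (φ : Ba →+* F).comp Algebra.TensorProduct.includeRight.toRingHom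
    have hψ : ψ.comp (algebraMap A[X] B) = (algebraMap K[X] F).comp s := by
      refine RingHom.ext fun x ↦ ?_
      have h1 : (1 : K[X]) ⊗ₜ[A[X]] (algebraMap A[X] B x) = algebraMap K[X] Ba (s x) := by
        rw [Algebra.TensorProduct.algebraMap_apply, Algebra.algebraMap_eq_smul_one,
          ← TensorProduct.smul_tmul, Algebra.smul_def, mul_one]
        rfl
      exact congr(φ $h1).trans (φ.commutes _)
    have hmem : ∀ b, ∃ x : K[X], algebraMap K[X] F x = ψ b := by
      intro b
      refine IsIntegrallyClosed.isIntegral_iff.mp ?_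
      have h1 : (algebraMap A[X] B).IsIntegralElem b := Algebra.IsIntegral.isIntegral b
      have h2 := RingHom.IsIntegralElem.map h1 ψ
      rw [hψ] at h2
      exact RingHom.IsIntegralElem.of_comp h2
    have hFinj := IsFractionRing.injective K[X] F
    let e := RingEquiv.ofBijective (algebraMap K[X] F).rangeRestrict
      ⟨fun x y hxy ↦ hFinj (Subtype.ext_iff.mp hxy), RingHom.rangeRestrict_surjective _⟩
    let β : B →+* K[X] := (e.symm : _ →+* K[X]).comp
      (ψ.codRestrict (algebraMap K[X] F).range fun b ↦ hmem b)
    have hβ' : ∀ b, algebraMap K[X] F (β b) = ψ b := fun b ↦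
      congr(($(e.apply_symm_apply (ψ.codRestrict (algebraMap K[X] F).range (fun b ↦ hmem b) b))).1)
    obtain ⟨ω, hω⟩ := hW K a β (RingHom.ext fun x ↦ hFinj <| by
      rw [RingHom.comp_apply, hβ']; exact congr($hψ x))
    exact ha ω hω
  obtain ⟨t, ht⟩ := h1 Ba hBaE
  refine ⟨t.comp (mapAlgHom a), fun b hb ↦ ?_⟩
  let : Algebra A[X] K := ((t : K[X] →+* K).comp s).toAlgebra
  let : Algebra K[X] K := (t : K[X] →+* K).toAlgebra
  have : IsScalarTower A[X] K[X] K := .of_algebraMap_eq' rfl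
  let b' : B →ₐ[A[X]] K := { b with commutes' := fun x ↦ congr($hb x) }
  let c : Ba →ₐ[K[X]] K := Algebra.TensorProduct.lift (Algebra.ofId K[X] K) b'
    fun _ _ ↦ Commute.all _ _
  exact ht c c.comp_algebraMap

theorem AlgHP.of_field : AlgHP K K := by
  intro B _ _ _ hB
  refine ⟨AlgHom.id K K, fun b hb ↦ hB.false ?_⟩
  exact { (algebraMap K (FractionRing K)).comp b with
    commutes' := fun x ↦ congr(algebraMap K (FractionRing K) ($hb x)) }

/-- If the affine line has the Hilbert property, then so have all affine spaces. -/
theorem AlgHP.mvPolynomial (h1 : AlgHP K (Polynomial K)) (n : ℕ) :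
    AlgHP K (MvPolynomial (Fin n) K) := by
  induction n with
  | zero => exact AlgHP.of_field.of_algEquiv (MvPolynomial.isEmptyAlgEquiv K (Fin 0)).symm
  | succ n ih =>
    exact (ih.polynomial h1).of_algEquiv (MvPolynomial.finSuccEquiv K n).symm

theorem isFractionRing_of_isLocalization_away {A : Type*} [CommRing A] [IsDomain A] {g : A}
    (hg : g ≠ 0) (S : Type*) [CommRing S] [Algebra A S] [IsLocalization.Away g S] (F : Type*)
    [Field F] [Algebra A F] [Algebra S F] [IsScalarTower A S F] [IsFractionRing S F] :
    IsFractionRing A F := by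
  have hSinj : Function.Injective (algebraMap A S) :=
    IsLocalization.injective S (powers_le_nonZeroDivisors_of_noZeroDivisors hg)
  have hinj : Function.Injective (algebraMap A F) := by
    rw [IsScalarTower.algebraMap_eq A S F]
    exact (IsFractionRing.injective S F).comp hSinj
  have : FaithfulSMul A F := (faithfulSMul_iff_algebraMap_injective _ _).mpr hinj
  refine IsFractionRing.of_field A F fun z ↦ ?_
  obtain ⟨x, y, hy, rfl⟩ := IsFractionRing.div_surjective (A := S) z
  obtain ⟨⟨x', ⟨s, hs⟩⟩, hx⟩ := IsLocalization.surj (Submonoid.powers g) x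
  obtain ⟨⟨y', ⟨t, ht⟩⟩, hy'⟩ := IsLocalization.surj (Submonoid.powers g) y
  have hs0 : algebraMap A F s ≠ 0 := by
    rw [IsScalarTower.algebraMap_apply A S F]
    exact ((IsLocalization.map_units S (⟨s, hs⟩ : Submonoid.powers g)).map
      (algebraMap S F)).ne_zero
  have ht0 : algebraMap A F t ≠ 0 := by
    rw [IsScalarTower.algebraMap_apply A S F]
    exact ((IsLocalization.map_units S (⟨t, ht⟩ : Submonoid.powers g)).map
      (algebraMap S F)).ne_zero
  have hx2 := congr(algebraMap S F $hx)
  have hy2 := congr(algebraMap S F $hy')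
  simp only [map_mul, ← IsScalarTower.algebraMap_apply A S F] at hx2 hy2
  refine ⟨x' * t, y' * s, ?_⟩
  rw [map_mul, map_mul, ← hx2, ← hy2]
  have : algebraMap S F y ≠ 0 := by
    have : Nontrivial S := hSinj.nontrivial
    simpa using nonZeroDivisors.ne_zero hy
  field_simp

/-- The Hilbert property passes to nonempty basic open subsets. -/
theorem AlgHP.away (h : AlgHP K A) {g : A} (S : Type u) [CommRing S] [IsDomain S]
    [Algebra K S] [Algebra A S] [IsScalarTower K A S] [IsLocalization.Away g S] (hg : g ≠ 0) :
    AlgHP K S := by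
  intro B _ _ _ hB
  let : Algebra A B := ((algebraMap S B).comp (algebraMap A S)).toAlgebra
  have : IsScalarTower A S B := .of_algebraMap_eq' rfl
  obtain ⟨t, ht⟩ := (inferInstance : Algebra.FiniteType S B).out
  choose m hm using fun x : B ↦ IsIntegral.exists_multiple_integral_of_isLocalization
    (Submonoid.powers g) (Rₘ := S) x (Algebra.IsIntegral.isIntegral x)
  classical
  -- a finite `A`-algebra with `B' [1 / g] = B`, generated by multiples of generators of `B`
  let B' := Algebra.adjoin A ((t.image fun x ↦ m x • x : Finset B) : Set B)
  have : Module.Finite A B' := by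
    refine Algebra.finite_adjoin_of_finite_of_isIntegral (Finset.finite_toSet _) ?_
    intro x hx
    obtain ⟨y, -, rfl⟩ := Finset.mem_image.mp (Finset.mem_coe.mp hx)
    exact hm y
  have hgunit : IsUnit (algebraMap A B g) := by
    rw [IsScalarTower.algebraMap_apply A S B]
    exact (IsLocalization.Away.algebraMap_isUnit g).map _
  have hsurj : ∀ x : B, ∃ n : ℕ, algebraMap A B (g ^ n) * x ∈ B' := by
    intro x
    have hx : x ∈ Algebra.adjoin S (t : Set B) := by rw [ht]; trivial
    induction hx using Algebra.adjoin_induction with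
    | mem x hx =>
      obtain ⟨n, hn⟩ := (m x).2
      refine ⟨n, ?_⟩
      have : m x • x ∈ B' := Algebra.subset_adjoin (Finset.mem_image_of_mem _ hx)
      rw [← Algebra.smul_def]
      change g ^ n = _ at hn
      rw [hn]
      exact this
    | algebraMap r =>
      obtain ⟨⟨x, ⟨_, n, rfl⟩⟩, hx⟩ := IsLocalization.surj (Submonoid.powers g) r
      refine ⟨n, ?_⟩
      rw [IsScalarTower.algebraMap_apply A S B, ← map_mul, mul_comm]
      change algebraMap S B (r * algebraMap A S (g ^ n)) ∈ _
      rw [hx, ← IsScalarTower.algebraMap_apply A S B]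
      exact B'.algebraMap_mem _
    | add x y _ _ hx hy =>
      obtain ⟨n, hn⟩ := hx
      obtain ⟨k, hk⟩ := hy
      refine ⟨n + k, ?_⟩
      have : algebraMap A B (g ^ (n + k)) * (x + y) =
        algebraMap A B (g ^ k) * (algebraMap A B (g ^ n) * x) +
        algebraMap A B (g ^ n) * (algebraMap A B (g ^ k) * y) := by
          rw [pow_add, map_mul]; ring
      rw [this]
      exact add_mem (mul_mem (B'.algebraMap_mem _) hn) (mul_mem (B'.algebraMap_mem _) hk)
    | mul x y _ _ hx hy =>
      obtain ⟨n, hn⟩ := hx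
      obtain ⟨k, hk⟩ := hy
      refine ⟨n + k, ?_⟩
      have : algebraMap A B (g ^ (n + k)) * (x * y) =
        (algebraMap A B (g ^ n) * x) * (algebraMap A B (g ^ k) * y) := by
          rw [pow_add, map_mul]; ring
      rw [this]
      exact mul_mem hn hk
  have : IsLocalization.Away (algebraMap A B' g) B := by
    refine ⟨?_, ?_, ?_⟩
    · rintro ⟨_, n, rfl⟩
      rw [map_pow]
      exact hgunit.pow n
    · intro x
      obtain ⟨n, hn⟩ := hsurj x
      refine ⟨⟨⟨_, hn⟩, ⟨_, n, rfl⟩⟩, ?_⟩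
      rw [mul_comm]
      exact congr($(by simp) * x)
    · intro x y hxy
      exact ⟨1, by rw [Subtype.ext hxy]⟩
  have : IsFractionRing A (FractionRing S) :=
    isFractionRing_of_isLocalization_away hg S _
  have hE : IsEmpty (B' →ₐ[A] FractionRing A) := by
    refine ⟨fun φ₀ ↦ ?_⟩
    let φ : B' →ₐ[A] FractionRing S := (FractionRing.algEquiv A (FractionRing S)).toAlgHom.comp φ₀
    have hu : IsUnit ((φ : B' →+* FractionRing S) (algebraMap A B' g)) := by
      have : (φ : B' →+* FractionRing S) (algebraMap A B' g) = _ := φ.commutes g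
      rw [this, IsScalarTower.algebraMap_apply A S]
      exact (IsLocalization.Away.algebraMap_isUnit g).map _
    let ψ : B →+* FractionRing S := IsLocalization.Away.lift (algebraMap A B' g) hu
    refine hB.false { ψ with commutes' := fun x ↦ ?_ }
    have : ψ.comp (algebraMap S B) = algebraMap S (FractionRing S) := by
      refine IsLocalization.ringHom_ext (Submonoid.powers g) ?_
      ext x
      rw [RingHom.comp_apply, RingHom.comp_apply, ← IsScalarTower.algebraMap_apply A S B,
        IsScalarTower.algebraMap_apply A B' B]
      refine (IsLocalization.Away.lift_eq _ hu _).trans ?_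
      exact φ.commutes x
    exact congr($this x)
  obtain ⟨a, hag, ha⟩ := h.exists_ne_zero hg B' hE
  have hu : IsUnit ((a : A →+* K) g) := isUnit_iff_ne_zero.mpr hag
  let a' : S →+* K := IsLocalization.Away.lift g hu
  have ha' : ∀ x, a' (algebraMap A S x) = a x := fun x ↦ IsLocalization.Away.lift_eq g hu x
  refine ⟨{ a' with commutes' := fun x ↦ ?_ }, fun b hb ↦ ?_⟩
  · change a' _ = _
    rw [IsScalarTower.algebraMap_apply K A S, ha', a.commutes]
  · refine ha (b.comp (algebraMap B' B)) (RingHom.ext fun x ↦ ?_)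
    rw [RingHom.comp_apply, RingHom.comp_apply, ← IsScalarTower.algebraMap_apply A B' B,
      IsScalarTower.algebraMap_apply A S B]
    exact (congr($hb _)).trans (ha' x)

end Permanence

/-! ### Finiteness of the integral closure -/

section IntegralClosure

open MvPolynomial in
/-- A polynomial ring `P` over a field has finite extensions which are again integrally closed (they
are polynomial rings), and in which finitely many given elements of `P` acquire roots of order a
power of the characteristic exponent. -/
theorem exists_finite_isIntegrallyClosed_pow {K Ω : Type u} [Field K] {d : ℕ} [Field Ω]
    [IsAlgClosed Ω] [Algebra (MvPolynomial (Fin d) K) Ω]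
    (hinj : Function.Injective (algebraMap (MvPolynomial (Fin d) K) Ω)) (p n : ℕ) [ExpChar K p]
    (T : Finset (MvPolynomial (Fin d) K)) :
    ∃ (Q : Type u) (_ : CommRing Q) (_ : IsDomain Q) (_ : Algebra (MvPolynomial (Fin d) K) Q)
      (_ : Algebra Q Ω) (_ : IsScalarTower (MvPolynomial (Fin d) K) Q Ω),
      Function.Injective (algebraMap Q Ω) ∧ Module.Finite (MvPolynomial (Fin d) K) Q ∧
      IsIntegrallyClosed Q ∧
      ∀ t ∈ T, ∃ y : Q, y ^ p ^ n = algebraMap (MvPolynomial (Fin d) K) Q t := by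
  classical
  let P := MvPolynomial (Fin d) K
  have hN : 0 < p ^ n := expChar_pow_pos K p n
  have hroot (x : Ω) : ∃ y, y ^ p ^ n = x := IsAlgClosed.exists_pow_nat_eq x hN
  choose rt hrt using hroot
  let : Algebra K Ω := ((algebraMap P Ω).comp C).toAlgebra
  have hKΩ (c : K) : algebraMap K Ω c = algebraMap P Ω (C c) := rfl
  let R : Finset Ω := T.biUnion fun t ↦ t.support.image fun m ↦ rt (algebraMap K Ω (t.coeff m))
  -- the field generated by the roots of the coefficients of the elements of `T`
  let K' : IntermediateField K Ω := IntermediateField.adjoin K (R : Set Ω)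
  have hfin : FiniteDimensional K K' := by
    refine IntermediateField.finiteDimensional_adjoin fun x hx ↦ ?_
    obtain ⟨t, -, hx⟩ := Finset.mem_biUnion.mp (Finset.mem_coe.mp hx)
    obtain ⟨m, -, rfl⟩ := Finset.mem_image.mp hx
    refine IsIntegral.of_pow hN ?_
    rw [hrt]
    exact isIntegral_algebraMap
  let R' := MvPolynomial (Fin d) K'
  -- the variables of `R'` are the roots of those of `P`
  let γ : P →+* R' := eval₂Hom ((C : K' →+* R').comp (algebraMap K K')) fun i ↦ X i ^ p ^ n
  let : Algebra P R' := γ.toAlgebra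
  let ψ₀ : R' →+* Ω := eval₂Hom (algebraMap K' Ω) fun i ↦ rt (algebraMap P Ω (X i))
  have hψγ : ψ₀.comp γ = algebraMap P Ω := by
    refine MvPolynomial.ringHom_ext (fun c ↦ ?_) fun i ↦ ?_
    · simp [ψ₀, γ, ← hKΩ, P, R', ← IsScalarTower.algebraMap_apply]
    · simp [ψ₀, γ, hrt, P, R']
  let ψ : R' →ₐ[P] Ω := { ψ₀ with commutes' := fun x ↦ congr($hψγ x) }
  have : Algebra.IsIntegral P R' := by
    refine ⟨fun x ↦ ?_⟩
    induction x using MvPolynomial.induction_on with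
    | C a =>
      have h1 : (algebraMap K K').IsIntegralElem a := Algebra.IsIntegral.isIntegral a
      have h2 := h1.map (C : K' →+* R')
      have h3 : (C : K' →+* R').comp (algebraMap K K') = (algebraMap P R').comp C := by
        ext1 c
        exact (eval₂_C _ _ c).symm
      rw [h3] at h2
      exact RingHom.IsIntegralElem.of_comp h2
    | add f g hf hg => exact hf.add hg
    | mul_X f i hp =>
      refine hp.mul (IsIntegral.of_pow hN ?_)
      have : (X i : R') ^ p ^ n = algebraMap P R' (X i : P) :=
        (eval₂_X ((C : K' →+* R').comp (algebraMap K K')) (fun i ↦ X i ^ p ^ n) i).symm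
      rw [this]
      exact isIntegral_algebraMap
  have : Algebra.FiniteType P R' := by
    let : Algebra K R' := ((algebraMap P R').comp C).toAlgebra
    have : IsScalarTower K P R' := .of_algebraMap_eq' rfl
    have h3 : (C : K' →+* R').comp (algebraMap K K') = (algebraMap P R').comp C := by
      ext1 c
      exact (eval₂_C _ _ c).symm
    have : IsScalarTower K K' R' := .of_algebraMap_eq' h3.symm
    have : Algebra.FiniteType K R' := .trans (S := K') inferInstance inferInstance
    exact .of_restrictScalars_finiteType K P R'
  have : Module.Finite P R' := Algebra.IsIntegral.finite
  have hψinj : Function.Injective ψ := by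
    rw [← AlgHom.coe_toRingHom, RingHom.injective_iff_ker_eq_bot]
    refine Ideal.eq_bot_of_comap_eq_bot (R := P) ?_
    rw [RingHom.comap_ker, AlgHom.comp_algebraMap]
    exact (RingHom.injective_iff_ker_eq_bot _).mp hinj
  have hR' : IsIntegrallyClosed R' := UniqueFactorizationMonoid.instIsIntegrallyClosed
  refine ⟨R', inferInstance, inferInstance, inferInstance, ψ₀.toAlgebra,
    let _ : Algebra R' Ω := ψ₀.toAlgebra; .of_algebraMap_eq' hψγ.symm, hψinj, inferInstance, hR',
    fun t ht ↦ ?_⟩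
  have hmem (m) (hm : m ∈ t.support) : rt (algebraMap K Ω (t.coeff m)) ∈ K' :=
    IntermediateField.subset_adjoin _ _
      (Finset.mem_biUnion.mpr ⟨t, ht, Finset.mem_image_of_mem _ hm⟩)
  let y : R' := ∑ m ∈ t.support.attach, monomial m.1 ⟨_, hmem m.1 m.2⟩
  have : ExpChar R' p := expChar_of_injective_ringHom (R := K) (A := R')
    (f := (C : K' →+* R').comp (algebraMap K K')) ((C_injective _ _).comp (algebraMap K K').injective)
    p
  have hy : y ^ p ^ n = γ t := by
    rw [sum_pow_char_pow]
    conv_rhs => rw [← support_sum_monomial_coeff t, map_sum, ← Finset.sum_attach]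
    refine Finset.sum_congr rfl fun m _ ↦ ?_
    have h1 : (⟨_, hmem m.1 m.2⟩ : K') ^ p ^ n = algebraMap K K' (t.coeff m.1) :=
      Subtype.ext (hrt _)
    rw [monomial_pow, h1]
    refine Eq.trans ?_ (eval₂_monomial _ _).symm
    rw [monomial_eq, RingHom.comp_apply]
    congr 1
    rw [Finsupp.prod_of_support_subset _ (s := m.1.support) Finsupp.support_smul _ (by simp)]
    simp [Finsupp.prod, pow_mul]
  exact ⟨y, hy⟩

/-- For a finite extension `L/E` of characteristic exponent `p`, the `p ^ n`-th power of any element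
of `L`, for large `n`, is a combination of `p ^ n`-th powers of separable elements. -/
theorem exists_finset_separable_pow (E L : Type*) [Field E] [Field L] [Algebra E L]
    [FiniteDimensional E L] (p : ℕ) [ExpChar E p] :
    ∃ (n : ℕ) (s : Finset L), (∀ x ∈ s, IsSeparable E x) ∧
      ∃ b : Finset L, Submodule.span E (b : Set L) = ⊤ ∧
        ∀ x ∈ b, x ^ p ^ n ∈ Submodule.span E ((· ^ p ^ n) '' (s : Set L)) := by
  classical
  let E' := separableClosure E L
  have : ExpChar E' p := expChar_of_injective_algebraMap (algebraMap E E').injective p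
  obtain ⟨b, hb⟩ := Module.finite_def.mp (inferInstance : FiniteDimensional E L)
  obtain ⟨c, hc⟩ := Module.finite_def.mp (inferInstance : FiniteDimensional E E')
  choose k hk using fun x : L ↦ IsPurelyInseparable.pow_mem E' p x
  refine ⟨b.sup k, c.image (algebraMap E' L), fun x hx ↦ ?_, b, hb, fun x hx ↦ ?_⟩
  · obtain ⟨y, -, rfl⟩ := Finset.mem_image.mp hx
    exact mem_separableClosure_iff.mp y.2
  · obtain ⟨m, hm⟩ := Nat.exists_eq_add_of_le (Finset.le_sup hx : k x ≤ b.sup k)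
    obtain ⟨y, hy⟩ := hk x
    have h1 : x ^ p ^ b.sup k = algebraMap E' L (y ^ p ^ m) := by
      rw [hm, pow_add, pow_mul, ← hy, map_pow]
    have h2 := Field.span_map_pow_expChar_pow_eq_top_of_isSeparable (F := E) (E := E') p
      (b.sup k) (v := ((↑) : c → E')) (by simpa using hc)
    have h3 : y ^ p ^ m ∈ Submodule.span E (Set.range fun i : c ↦ (i : E') ^ p ^ b.sup k) := by
      rw [h2]; trivial
    have h4 := Submodule.mem_map_of_mem (f := (IsScalarTower.toAlgHom E E' L).toLinearMap) h3
    rw [Submodule.map_span] at h4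
    rw [h1]
    refine Submodule.span_mono ?_ h4
    rintro _ ⟨_, ⟨i, rfl⟩, rfl⟩
    exact ⟨i, Finset.mem_image_of_mem _ i.2, (map_pow (algebraMap E' L) _ _).symm⟩

/-- Finiteness of the integral closure of `P` in `L` can be checked after embedding `L` into a finite
separable extension of the fraction field of an integrally closed finite `P`-algebra. -/
theorem finite_integralClosure_of_separable {P Q M Ω L : Type*} [CommRing P] [IsNoetherianRing P]
    [CommRing Q] [IsDomain Q] [IsIntegrallyClosed Q] [Algebra P Q] [Module.Finite P Q]
    [Field M] [Algebra Q M] [IsFractionRing Q M] [Field Ω] [Algebra M Ω] [Algebra Q Ω]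
    [IsScalarTower Q M Ω] [Algebra P Ω] [IsScalarTower P Q Ω] [Field L] [Algebra P L] [Algebra L Ω]
    [IsScalarTower P L Ω] (L' : IntermediateField M Ω) [FiniteDimensional M L']
    [Algebra.IsSeparable M L'] (hL' : ∀ x : L, algebraMap L Ω x ∈ L') :
    Module.Finite P (integralClosure P L) := by
  have : IsNoetherianRing Q := isNoetherian_of_isNoetherianRing_of_finite P Q |> fun _ ↦
    isNoetherian_of_tower P inferInstance
  have : Module.Finite Q (integralClosure Q L') :=
    IsIntegralClosure.finite Q M L' (integralClosure Q L')
  let g : integralClosure Q L' →ₗ[Q] Ω :=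
    { toFun x := ((x : L') : Ω)
      map_add' _ _ := rfl
      map_smul' c x := by
        have : (((c • x : integralClosure Q L') : L') : Ω) = c • ((x : L') : Ω) := rfl
        rw [this]; rfl }
  let N : Submodule Q Ω := LinearMap.range g
  have : Module.Finite P N := Module.Finite.trans Q N
  let f : integralClosure P L →ₗ[P] N.restrictScalars P :=
    { toFun x := ⟨algebraMap L Ω x, by
        have hx : IsIntegral Q (algebraMap L Ω x) := (x.2.algebraMap (B := Ω)).tower_top
        refine ⟨⟨⟨_, hL' x⟩, ?_⟩, rfl⟩
        have : IsScalarTower Q L' Ω := .of_algebraMap_eq fun x ↦ by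
          rw [IsScalarTower.algebraMap_apply Q M Ω, IsScalarTower.algebraMap_apply Q M L',
            ← IsScalarTower.algebraMap_apply M L' Ω]
        exact (isIntegral_algHom_iff (IsScalarTower.toAlgHom Q L' Ω)
          (algebraMap L' Ω).injective).mp hx⟩
      map_add' x y := Subtype.ext (map_add (algebraMap L Ω) _ _)
      map_smul' c x := Subtype.ext (by
        simp [Algebra.smul_def, ← IsScalarTower.algebraMap_apply]) }
  have : Module.Finite P (N.restrictScalars P) := this
  have : IsNoetherian P (N.restrictScalars P) := isNoetherian_of_isNoetherianRing_of_finite P _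
  exact Module.Finite.of_injective f fun x y hxy ↦
    Subtype.ext ((algebraMap L Ω).injective (Subtype.ext_iff.mp hxy))

open MvPolynomial in
/-- The integral closure of a polynomial ring `P` over a field in a finite extension `L` of its fraction
field `E` is finite. As an integrally closed ring has finite integral closure in separable
extensions, it is enough to find a finite integrally closed `P`-algebra `Q` such that `L` is contained
in a separable extension of `Frac Q`. The `p ^ n`-th powers of generators of `L` are combinations of
`p ^ n`-th powers of separable elements; it suffices that `Frac Q` contains the `p ^ n`-th roots of the
coefficients. -/
theorem finite_integralClosure_mvPolynomial {K : Type u} [Field K] {d : ℕ} (E L : Type u) [Field E]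
    [Field L] [Algebra (MvPolynomial (Fin d) K) E] [IsFractionRing (MvPolynomial (Fin d) K) E]
    [Algebra E L] [Algebra (MvPolynomial (Fin d) K) L] [IsScalarTower (MvPolynomial (Fin d) K) E L]
    [FiniteDimensional E L] :
    Module.Finite (MvPolynomial (Fin d) K) (integralClosure (MvPolynomial (Fin d) K) L) := by
  classical
  let P := MvPolynomial (Fin d) K
  obtain ⟨p, _⟩ := ExpChar.exists K
  have : ExpChar E p := expChar_of_injective_ringHom (R := K) (A := E)
    (f := (algebraMap P E).comp C) ((IsFractionRing.injective P E).comp (C_injective _ _)) p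
  obtain ⟨n, s, hs, b, hb, hbs⟩ := exists_finset_separable_pow E L p
  have hc : ∀ x : L, ∃ c : L → E, x ∈ b → ∑ y ∈ s, c y • y ^ p ^ n = x ^ p ^ n := fun x ↦ by
    by_cases hx : x ∈ b
    · obtain ⟨c, hc⟩ := (Submodule.mem_span_image_finset_iff_exists_fun' E).mp (hbs x hx)
      exact ⟨c, fun _ ↦ hc⟩
    · exact ⟨0, fun h ↦ (hx h).elim⟩
  choose c hc using hc
  choose u v hv huv using fun e : E ↦ IsFractionRing.div_surjective (A := P) e
  -- the numerators and denominators of the finitely many coefficients that occur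
  let T : Finset P := (b ×ˢ s).image (fun z ↦ u (c z.1 z.2)) ∪ (b ×ˢ s).image fun z ↦ v (c z.1 z.2)
  let Ω := AlgebraicClosure L
  have hPΩ : Function.Injective (algebraMap P Ω) := by
    rw [IsScalarTower.algebraMap_eq P E Ω]
    exact (algebraMap E Ω).injective.comp (IsFractionRing.injective P E)
  obtain ⟨Q, _, _, _, _, _, hQΩ, _, _, hQ⟩ :=
    exists_finite_isIntegrallyClosed_pow hPΩ p n T
  have hPQ : Function.Injective (algebraMap P Q) := fun x y hxy ↦ hPΩ <| by
    rw [IsScalarTower.algebraMap_apply P Q Ω, IsScalarTower.algebraMap_apply P Q Ω, hxy]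
  have : FaithfulSMul P Q := (faithfulSMul_iff_algebraMap_injective _ _).mpr hPQ
  have : FaithfulSMul Q Ω := (faithfulSMul_iff_algebraMap_injective _ _).mpr hQΩ
  let M := FractionRing Q
  let : Algebra M Ω := FractionRing.liftAlgebra Q Ω
  let : Algebra E M := (IsFractionRing.lift (K := E) (g := algebraMap P M)
    (FaithfulSMul.algebraMap_injective P M)).toAlgebra
  have hPEM (x : P) : algebraMap E M (algebraMap P E x) = algebraMap P M x :=
    IsFractionRing.lift_algebraMap _ x
  have : IsScalarTower E M Ω := .of_algebraMap_eq' <| by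
    refine IsLocalization.ringHom_ext (nonZeroDivisors P) (RingHom.ext fun x ↦ ?_)
    rw [RingHom.comp_apply, RingHom.comp_apply, RingHom.comp_apply, hPEM,
      ← IsScalarTower.algebraMap_apply P E Ω, IsScalarTower.algebraMap_apply P Q M,
      ← IsScalarTower.algebraMap_apply Q M Ω, ← IsScalarTower.algebraMap_apply P Q Ω]
  let L' : IntermediateField M Ω := IntermediateField.adjoin M (algebraMap L Ω '' s)
  have hsep : ∀ x ∈ algebraMap L Ω '' s, IsSeparable M x := by
    rintro _ ⟨y, hy, rfl⟩
    have h1 : IsSeparable E (algebraMap L Ω y) := by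
      rw [IsSeparable, minpoly.algebraMap_eq (algebraMap L Ω).injective]
      exact hs y hy
    exact h1.tower_top M
  have : FiniteDimensional M L' := by
    have : Finite (algebraMap L Ω '' s) := (s.finite_toSet.image _).to_subtype
    exact IntermediateField.finiteDimensional_adjoin fun x hx ↦ (hsep x hx).isIntegral
  have : Algebra.IsSeparable M L' :=
    (IntermediateField.isSeparable_adjoin_iff_isSeparable M Ω).mpr hsep
  have hQL' (x : Q) : algebraMap Q Ω x ∈ L' := by
    rw [IsScalarTower.algebraMap_apply Q M Ω]
    exact L'.algebraMap_mem _
  have hEL' (x : E) : algebraMap E Ω x ∈ L' := by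
    rw [IsScalarTower.algebraMap_apply E M Ω]
    exact L'.algebraMap_mem _
  have : ExpChar Ω p := expChar_of_injective_algebraMap (algebraMap E Ω).injective p
  refine finite_integralClosure_of_separable (Q := Q) L' fun x ↦ ?_
  have hx : x ∈ Submodule.span E (b : Set L) := hb ▸ trivial
  induction hx using Submodule.span_induction with
  | zero => rw [map_zero]; exact zero_mem L'
  | add x y _ _ hx hy => rw [map_add]; exact add_mem hx hy
  | smul e x _ hx =>
    rw [Algebra.smul_def, map_mul, ← IsScalarTower.algebraMap_apply]
    exact mul_mem (hEL' e) hx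
  | mem x hx =>
    have hxs (y) (hy : y ∈ s) : ∃ z ∈ L', z ^ p ^ n = algebraMap E Ω (c x y) := by
      have hxy : (x, y) ∈ b ×ˢ s := Finset.mem_product.mpr ⟨hx, hy⟩
      obtain ⟨z₁, h1⟩ := hQ _ (Finset.mem_union_left _ (Finset.mem_image_of_mem _ hxy))
      obtain ⟨z₂, h2⟩ := hQ _ (Finset.mem_union_right _ (Finset.mem_image_of_mem _ hxy))
      refine ⟨algebraMap Q Ω z₁ / algebraMap Q Ω z₂, div_mem (hQL' _) (hQL' _), ?_⟩
      rw [div_pow, ← map_pow, ← map_pow, h1, h2]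
      conv_rhs => rw [← huv (c x y), map_div₀]
      simp only [← IsScalarTower.algebraMap_apply]
      rfl
    choose! z hz hzn using hxs
    have h1 : algebraMap L Ω x ^ p ^ n = (∑ y ∈ s, z y * algebraMap L Ω y) ^ p ^ n := by
      rw [sum_pow_char_pow, ← map_pow, ← hc x hx, map_sum]
      refine Finset.sum_congr rfl fun y hy ↦ ?_
      rw [mul_pow, hzn y hy, Algebra.smul_def, map_mul, map_pow,
        ← IsScalarTower.algebraMap_apply]
    rw [iterateFrobenius_inj Ω p n h1]
    exact sum_mem fun y hy ↦ mul_mem (hz y hy)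
      (IntermediateField.subset_adjoin _ _ ⟨y, hy, rfl⟩)

/-- Finitely generated domains over a field have finite integral closure in every finite extension of
their fraction field, separable or not. -/
theorem finite_integralClosure (K : Type u) {A : Type u} (F L : Type u) [Field K] [CommRing A]
    [IsDomain A] [Algebra K A] [Algebra.FiniteType K A] [Field F] [Algebra A F]
    [IsFractionRing A F] [Field L] [Algebra F L] [Algebra A L] [IsScalarTower A F L]
    [FiniteDimensional F L] : Module.Finite A (integralClosure A L) := by
  -- Noether normalization
  obtain ⟨s, f, hf, hfin⟩ := exists_finite_inj_algHom_of_fg K A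
  let P := MvPolynomial (Fin s) K
  let : Algebra P A := f.toRingHom.toAlgebra
  have : Module.Finite P A := hfin
  have : FaithfulSMul P A := (faithfulSMul_iff_algebraMap_injective _ _).mpr hf
  let : Algebra P F := ((algebraMap A F).comp (algebraMap P A)).toAlgebra
  have : IsScalarTower P A F := .of_algebraMap_eq' rfl
  let : Algebra P L := ((algebraMap A L).comp (algebraMap P A)).toAlgebra
  have : IsScalarTower P A L := .of_algebraMap_eq' rfl
  have : IsScalarTower P F L := .of_algebraMap_eq fun x ↦ by
    rw [IsScalarTower.algebraMap_apply P A L, IsScalarTower.algebraMap_apply P A F,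
      ← IsScalarTower.algebraMap_apply A F L]
  have : FaithfulSMul A F := (faithfulSMul_iff_algebraMap_injective _ _).mpr
    (IsFractionRing.injective A F)
  have : FaithfulSMul P F := .trans P A F
  let E := FractionRing P
  let : Algebra E F := FractionRing.liftAlgebra P F
  let : Algebra E L := ((algebraMap F L).comp (algebraMap E F)).toAlgebra
  have : IsScalarTower E F L := .of_algebraMap_eq' rfl
  have : IsScalarTower P E L := .of_algebraMap_eq fun x ↦ by
    rw [IsScalarTower.algebraMap_apply P F L, IsScalarTower.algebraMap_apply P E F,
      ← IsScalarTower.algebraMap_apply E F L]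
  have : Module.Finite E F := Module.Finite.of_isLocalization P A (nonZeroDivisors P)
  have : Module.Finite E L := .trans F L
  have := finite_integralClosure_mvPolynomial (K := K) (d := s) E L
  let e : integralClosure P L →ₗ[P] integralClosure A L :=
    { toFun x := ⟨x, x.2.tower_top⟩
      map_add' _ _ := rfl
      map_smul' c x := Subtype.ext (by
        change c • (x : L) = c • (x : L)
        rfl) }
  have : Module.Finite P (integralClosure A L) :=
    Module.Finite.of_surjective e fun x ↦ ⟨⟨x, isIntegral_trans (R := P) (A := A) x.1 x.2⟩, rfl⟩
  exact Module.Finite.of_restrictScalars_finite P A _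

end IntegralClosure

/-! ### Regular extensions from dense rational points -/

section PointsDense

open TensorProduct

variable {K D E : Type u} [Field K] [CommRing D] [IsDomain D] [Algebra K D] [Field E] [Algebra K E]

/-- A domain over `K` whose `K`-points are dense stays a domain after extension of scalars: the
`K`-points where the coordinates of `x` vanish and those where the coordinates of `y` vanish cover
everything if `x * y = 0`. -/
theorem isDomain_tensorProduct_of_dense_points
    (hD : ∀ d : D, (∀ a : D →ₐ[K] K, a d = 0) → d = 0) : IsDomain (D ⊗[K] E) := by
  let b := Module.Free.chooseBasis K E
  let bD := Algebra.TensorProduct.basis D b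
  let ev (a : D →ₐ[K] K) : D ⊗[K] E →ₐ[K] E :=
    Algebra.TensorProduct.lift ((Algebra.ofId K E).comp a) (AlgHom.id K E) fun _ _ ↦ .all _ _
  have hev (a : D →ₐ[K] K) (x : D ⊗[K] E) (i) : b.repr (ev a x) i = a (bD.repr x i) := by
    conv_lhs => rw [← bD.linearCombination_repr x, Finsupp.linearCombination_apply, Finsupp.sum,
      map_sum, map_sum]
    have hj : ∀ j, ev a (bD.repr x j • bD j) = a (bD.repr x j) • b j := fun j ↦ by
      rw [Algebra.TensorProduct.basis_apply, TensorProduct.smul_tmul', smul_eq_mul, mul_one,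
        Algebra.TensorProduct.lift_tmul, Algebra.smul_def]
      rfl
    simp only [hj, map_smul, Module.Basis.repr_self, Finsupp.smul_single, smul_eq_mul, mul_one,
      Finsupp.coe_finsetSum, Finset.sum_apply, Finsupp.single_apply, Finset.sum_ite_eq',
      Finsupp.mem_support_iff]
    split_ifs with h
    · rfl
    · rw [Finsupp.notMem_support_iff.mp h, map_zero]
  have : Nontrivial (D ⊗[K] E) :=
    (Algebra.TensorProduct.includeRight_injective (R := K) (A := D) (B := E)
      (algebraMap K D).injective).nontrivial
  have : NoZeroDivisors (D ⊗[K] E) := by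
    refine ⟨fun {x y} hxy ↦ ?_⟩
    by_contra! hcon
    obtain ⟨hx, hy⟩ := hcon
    obtain ⟨i, hi⟩ : ∃ i, bD.repr x i ≠ 0 := by
      by_contra! h
      exact hx (bD.repr.map_eq_zero_iff.mp (Finsupp.ext h))
    obtain ⟨j, hj⟩ : ∃ j, bD.repr y j ≠ 0 := by
      by_contra! h
      exact hy (bD.repr.map_eq_zero_iff.mp (Finsupp.ext h))
    refine mul_ne_zero hi hj (hD _ fun a ↦ ?_)
    have h0 : ev a x * ev a y = 0 := by rw [← map_mul, hxy, map_zero]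
    rw [map_mul, ← hev, ← hev]
    rcases mul_eq_zero.mp h0 with h | h <;> simp [h]
  exact NoZeroDivisors.to_isDomain _

/-- The fraction field of a domain over `K` with dense `K`-points is a regular extension of `K`. -/
theorem isDomain_fractionField_tensorProduct
    (hD : ∀ d : D, (∀ a : D →ₐ[K] K, a d = 0) → d = 0) (L : Type u) [Field L] [Algebra D L]
    [IsFractionRing D L] [Algebra K L] [IsScalarTower K D L] : IsDomain (L ⊗[K] E) := by
  have := isDomain_tensorProduct_of_dense_points (E := E) hD
  let m : D ⊗[K] E →ₐ[K] L ⊗[K] E :=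
    Algebra.TensorProduct.map (IsScalarTower.toAlgHom K D L) (AlgHom.id K E)
  have hm : Function.Injective m :=
    Module.Flat.rTensor_preserves_injective_linearMap (M := E)
      (IsScalarTower.toAlgHom K D L).toLinearMap (IsFractionRing.injective D L)
  have hne (s : D) (hs : s ≠ 0) : IsUnit ((algebraMap D L s) ⊗ₜ[K] (1 : E)) :=
    (isUnit_iff_ne_zero.mpr ((map_ne_zero_iff _ (IsFractionRing.injective D L)).mpr hs)).map
      (Algebra.TensorProduct.includeLeft : L →ₐ[K] L ⊗[K] E)
  have hfrac (z : L ⊗[K] E) : ∃ s : D, s ≠ 0 ∧ ∃ x, (algebraMap D L s) ⊗ₜ[K] (1 : E) * z = m x := by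
    induction z using TensorProduct.induction_on with
    | zero => exact ⟨1, one_ne_zero, 0, by simp⟩
    | tmul l e =>
      obtain ⟨x, s, hs, rfl⟩ := IsFractionRing.div_surjective (A := D) l
      refine ⟨s, nonZeroDivisors.ne_zero hs, x ⊗ₜ e, ?_⟩
      have : algebraMap D L s ≠ 0 :=
        (map_ne_zero_iff _ (IsFractionRing.injective D L)).mpr (nonZeroDivisors.ne_zero hs)
      rw [Algebra.TensorProduct.tmul_mul_tmul, one_mul, mul_div_cancel₀ _ this]
      rfl
    | add z w hz hw =>
      obtain ⟨s, hs, x, hx⟩ := hz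
      obtain ⟨t, ht, y, hy⟩ := hw
      refine ⟨s * t, mul_ne_zero hs ht, (t ⊗ₜ 1) * x + (s ⊗ₜ 1) * y, ?_⟩
      have hst : (algebraMap D L (s * t)) ⊗ₜ[K] (1 : E) =
          (algebraMap D L s) ⊗ₜ[K] (1 : E) * (algebraMap D L t) ⊗ₜ[K] (1 : E) := by
        rw [Algebra.TensorProduct.tmul_mul_tmul, one_mul, map_mul]
      have hms (s : D) : m (s ⊗ₜ 1) = (algebraMap D L s) ⊗ₜ[K] (1 : E) := rfl
      rw [hst, map_add, map_mul, map_mul, ← hx, ← hy, hms, hms]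
      ring
  have : Nontrivial (L ⊗[K] E) := hm.nontrivial
  have : NoZeroDivisors (L ⊗[K] E) := by
    refine ⟨fun {z w} hzw ↦ ?_⟩
    obtain ⟨s, hs, x, hx⟩ := hfrac z
    obtain ⟨t, ht, y, hy⟩ := hfrac w
    have hxy : m (x * y) = 0 := by
      rw [map_mul, ← hx, ← hy, mul_mul_mul_comm, hzw, mul_zero]
    rcases mul_eq_zero.mp ((map_eq_zero_iff m hm).mp hxy) with h | h
    · rw [h, map_zero] at hx
      exact .inl ((hne s hs).mul_right_eq_zero.mp hx)
    · rw [h, map_zero] at hy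
      exact .inr ((hne t ht).mul_right_eq_zero.mp hy)
  exact NoZeroDivisors.to_isDomain _

end PointsDense

theorem finiteDimensional_fractionField {A D F L : Type*} [CommRing A] [IsDomain A]
    [CommRing D] [IsDomain D]
    [Algebra A D] [Algebra.FiniteType A D] [Algebra.IsAlgebraic A D] [Field F] [Algebra A F]
    [IsFractionRing A F] [Field L] [Algebra D L] [IsFractionRing D L] [Algebra A L]
    [IsScalarTower A D L] [Algebra F L] [IsScalarTower A F L] : FiniteDimensional F L := by
  obtain ⟨t, ht⟩ := (inferInstance : Algebra.FiniteType A D).out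
  let M : IntermediateField F L := IntermediateField.adjoin F (algebraMap D L '' t)
  have hDM (x : D) : algebraMap D L x ∈ M := by
    have hx : x ∈ Algebra.adjoin A (t : Set D) := ht ▸ trivial
    induction hx using Algebra.adjoin_induction with
    | mem x hx => exact IntermediateField.subset_adjoin _ _ ⟨x, hx, rfl⟩
    | algebraMap r =>
      rw [← IsScalarTower.algebraMap_apply A D L, IsScalarTower.algebraMap_apply A F L]
      exact M.algebraMap_mem _
    | add x y _ _ hx hy => rw [map_add]; exact add_mem hx hy
    | mul x y _ _ hx hy => rw [map_mul]; exact mul_mem hx hy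
  have hM : M = ⊤ := by
    refine eq_top_iff.mpr fun l _ ↦ ?_
    obtain ⟨x, s, hs, rfl⟩ := IsFractionRing.div_surjective (A := D) l
    exact div_mem (hDM x) (hDM s)
  have : FiniteDimensional F M := by
    have : Finite (algebraMap D L '' t) := (t.finite_toSet.image _).to_subtype
    refine IntermediateField.finiteDimensional_adjoin fun x hx ↦ ?_
    obtain ⟨y, -, rfl⟩ := hx
    have h1 : IsAlgebraic A (algebraMap D L y) :=
      (Algebra.IsAlgebraic.isAlgebraic (R := A) y).algebraMap
    exact ((IsFractionRing.isAlgebraic_iff A F L).mp h1).isIntegral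
  rw [hM] at this
  exact IntermediateField.topEquiv.toLinearEquiv.finiteDimensional

/-- A dominant, generically finite affine scheme `Spec D → Spec A` without a rational section
contributes to the `K`-points of `Spec A`, up to a proper closed subset `g = 0`, only if `Frac D` is
regular over `K`, and then through the normalization of `Spec A` in `Frac D`. -/
theorem exists_regular_extension {K A : Type u} (F : Type u) [Field K] [CommRing A] [IsDomain A]
    [Algebra K A] [Algebra.FiniteType K A] [Field F] [Algebra A F] [IsFractionRing A F] (D : Type u)
    [CommRing D] [IsDomain D] [Algebra A D] [Algebra.FiniteType A D]
    (hfin : Function.Injective (algebraMap A D) → Algebra.IsAlgebraic A D)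
    (hD : IsEmpty (D →ₐ[A] F)) :
    ∃ g : A, g ≠ 0 ∧
      ((∀ (a : A →ₐ[K] K) (d : D →+* K), d.comp (algebraMap A D) = a → a g = 0) ∨
      ∃ (L : Type u) (_ : Field L) (_ : Algebra F L) (_ : Algebra A L) (_ : Algebra K L),
        IsScalarTower A F L ∧ IsScalarTower K A L ∧ FiniteDimensional F L ∧
        1 < Module.finrank F L ∧
        (∀ (E : Type u) [Field E] [Algebra K E], IsDomain (TensorProduct K L E)) ∧
        ∀ (a : A →ₐ[K] K) (d : D →+* K), d.comp (algebraMap A D) = a → a g ≠ 0 →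
          ∃ c : integralClosure A L →+* K, c.comp (algebraMap A _) = a) := by
  by_cases hinj : Function.Injective (algebraMap A D)
  swap
  · obtain ⟨g, hg, hg0⟩ : ∃ g, algebraMap A D g = 0 ∧ g ≠ 0 := by
      by_contra! h
      exact hinj ((injective_iff_map_eq_zero _).mpr h)
    exact ⟨g, hg0, .inl fun a d had ↦ by
      rw [← RingHom.coe_coe, ← had, RingHom.comp_apply, hg, map_zero]⟩
  have := hfin hinj
  let : Algebra K D := ((algebraMap A D).comp (algebraMap K A)).toAlgebra
  have : IsScalarTower K A D := .of_algebraMap_eq' rfl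
  by_cases hpt : ∀ x : D, (∀ d : D →ₐ[K] K, d x = 0) → x = 0
  swap
  -- the `K`-points of `Spec D` lie on a hypersurface, hence so do their images
  · push Not at hpt
    obtain ⟨x, hx, hx0⟩ := hpt
    obtain ⟨g, hg0, y, hy⟩ := (Algebra.IsAlgebraic.isAlgebraic (R := A) x).exists_nonzero_dvd
      (mem_nonZeroDivisors_of_ne_zero hx0)
    refine ⟨g, hg0, .inl fun a d had ↦ ?_⟩
    let d' : D →ₐ[K] K := { d with commutes' := fun c ↦ (congr($had _)).trans (a.commutes c) }
    rw [← RingHom.coe_coe, ← had, RingHom.comp_apply, hy, map_mul, show d x = 0 from hx d', zero_mul]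
  let L := FractionRing D
  have hAL : Function.Injective (algebraMap A L) := by
    rw [IsScalarTower.algebraMap_eq A D L]
    exact (IsFractionRing.injective D L).comp hinj
  let : Algebra F L := (IsFractionRing.lift (K := F) hAL).toAlgebra
  have : IsScalarTower A F L := .of_algebraMap_eq fun x ↦
    (IsFractionRing.lift_algebraMap hAL x).symm
  have hFL : FiniteDimensional F L := finiteDimensional_fractionField (A := A) (D := D)
  have hfinA : Module.Finite A (integralClosure A L) := finite_integralClosure K F L
  obtain ⟨t, ht⟩ := Module.finite_def.mp hfinA
  classical
  obtain ⟨⟨y, hy⟩, hyt⟩ := IsLocalization.exist_integer_multiples_of_finset (nonZeroDivisors D)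
    (t.image ((↑) : integralClosure A L → L))
  -- `g` times the integral closure of `A` in `L` is contained in `D`, as that closure is finite
  obtain ⟨g, hg0, z, hz⟩ := (Algebra.IsAlgebraic.isAlgebraic (R := A) y).exists_nonzero_dvd hy
  have hmul (c : integralClosure A L) : ∃ x : D, algebraMap D L x = algebraMap A L g * c := by
    have hc : c ∈ Submodule.span A (t : Set (integralClosure A L)) := ht ▸ trivial
    induction hc using Submodule.span_induction with
    | mem c hc =>
      obtain ⟨x, hx⟩ := hyt c (Finset.mem_image_of_mem _ hc)
      refine ⟨z * x, ?_⟩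
      rw [map_mul, hx, IsScalarTower.algebraMap_apply A D L, hz, map_mul]
      change algebraMap D L z * (y • (c : L)) = _
      rw [Algebra.smul_def]
      ring
    | zero => exact ⟨0, by simp⟩
    | add c c' _ _ h h' =>
      obtain ⟨x, hx⟩ := h
      obtain ⟨x', hx'⟩ := h'
      exact ⟨x + x', by rw [map_add, hx, hx']; push_cast; ring⟩
    | smul r c _ h =>
      obtain ⟨x, hx⟩ := h
      refine ⟨algebraMap A D r * x, ?_⟩
      rw [map_mul, hx, ← IsScalarTower.algebraMap_apply A D L]
      change _ = _ * (r • (c : L))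
      rw [Algebra.smul_def]
      ring
  choose e he using hmul
  refine ⟨g, hg0, .inr ⟨L, inferInstance, inferInstance, inferInstance, inferInstance,
    inferInstance, inferInstance, hFL, ?_, fun E _ _ ↦
      isDomain_fractionField_tensorProduct hpt L, fun a d had hag ↦ ?_⟩⟩
  · by_contra! h1
    have h2 : Module.finrank F L = 1 := le_antisymm h1 Module.finrank_pos
    have hbij : Function.Bijective (algebraMap F L) :=
      ⟨(algebraMap F L).injective, fun x ↦ by
        have : x ∈ (⊥ : Subalgebra F L) := by
          rw [Subalgebra.bot_eq_top_of_finrank_eq_one h2]; trivial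
        exact this⟩
    let ε : F ≃ₐ[F] L := AlgEquiv.ofBijective (Algebra.ofId F L) hbij
    exact hD.false ((ε.symm.toAlgHom.restrictScalars A).comp (IsScalarTower.toAlgHom A D L))
  · have hdg : d (algebraMap A D g) = a g := congr($had g)
    have hinjDL := IsFractionRing.injective D L
    refine ⟨
      { toFun c := d (e c) / a g
        map_one' := ?_
        map_mul' c c' := ?_
        map_zero' := ?_
        map_add' c c' := ?_ }, RingHom.ext fun x ↦ ?_⟩
    · have : e 1 = algebraMap A D g := hinjDL <| by
        rw [he, ← IsScalarTower.algebraMap_apply A D L]; simp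
      rw [this, hdg, div_self hag]
    · have : e (c * c') * algebraMap A D g = e c * e c' := hinjDL <| by
        rw [map_mul, map_mul, he, he, he, ← IsScalarTower.algebraMap_apply A D L]
        push_cast
        ring
      have := congr(d $this)
      rw [map_mul, map_mul, hdg] at this
      rw [div_mul_div_comm, ← this, mul_div_mul_right _ _ hag]
    · have : e 0 = 0 := hinjDL <| by rw [he]; simp
      rw [this, map_zero, zero_div]
    · have : e (c + c') = e c + e c' := hinjDL <| by
        rw [map_add, he, he, he]; push_cast; ring
      rw [this, map_add, add_div]
    · have : e (algebraMap A _ x) = algebraMap A D (g * x) := hinjDL <| by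
        rw [he, ← IsScalarTower.algebraMap_apply A D L, map_mul]
        rfl
      change d (e _) / a g = a x
      rw [this]
      have := congr($had (g * x))
      rw [RingHom.comp_apply] at this
      rw [this, RingHom.coe_coe, map_mul, mul_div_cancel_left₀ _ hag]

/-! ### Normalization in a field -/

section Normalization

variable {X : Scheme.{u}} {L : Type u} [Field L] (g : Spec (.of L) ⟶ X) [QuasiCompact g]
  [QuasiSeparated g]

/-- Sections of the normalization of `X` in a field `L`, regarded as elements of `L`. -/
def normalizationSections (U : X.Opens) (hU : g ⁻¹ᵁ U = ⊤) :
    Γ(g.normalization, g.fromNormalization ⁻¹ᵁ U) →+* L :=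
  (g.toNormalization.appLE (g.fromNormalization ⁻¹ᵁ U) ⊤
    (by rw [← Scheme.Hom.comp_preimage, g.toNormalization_fromNormalization, hU]) ≫
    (Scheme.ΓSpecIso (.of L)).hom).hom

/-- The ring homomorphism `Γ(X, U) → L` given by a morphism `Spec L ⟶ X` that lands in `U`. -/
def evalSections (U : X.Opens) (hU : g ⁻¹ᵁ U = ⊤) : Γ(X, U) →+* L :=
  (g.appLE U ⊤ hU.ge ≫ (Scheme.ΓSpecIso (.of L)).hom).hom

theorem normalizationSections_app (U : X.Opens) (hU : g ⁻¹ᵁ U = ⊤) (x : Γ(X, U)) :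
    normalizationSections g U hU (g.fromNormalization.app U x) = evalSections g U hU x := by
  have : g.fromNormalization.app U ≫ g.toNormalization.appLE (g.fromNormalization ⁻¹ᵁ U) ⊤
      (by rw [← Scheme.Hom.comp_preimage, g.toNormalization_fromNormalization, hU]) =
      g.appLE U ⊤ hU.ge := by
    rw [Scheme.Hom.app_eq_appLE, Scheme.Hom.appLE_comp_appLE]
    simp only [g.toNormalization_fromNormalization]
  exact congr((Scheme.ΓSpecIso (.of L)).hom.hom ($this x))

theorem normalizationSections_injective (U : X.Opens) (hU : g ⁻¹ᵁ U = ⊤) :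
    Function.Injective (normalizationSections g U hU) := by
  have : IsSchemeTheoreticallyDominant g.toNormalization := ⟨g.ker_toNormalization⟩
  have h1 := g.toNormalization.app_injective (g.fromNormalization ⁻¹ᵁ U)
  have h2 : g.toNormalization ⁻¹ᵁ g.fromNormalization ⁻¹ᵁ U = ⊤ := by
    rw [← Scheme.Hom.comp_preimage, g.toNormalization_fromNormalization, hU]
  have h3 : Function.Injective ((Spec (.of L)).presheaf.map (homOfLE h2.ge).op) := by
    have : IsIso (homOfLE h2.ge) := by
      rw [show homOfLE h2.ge = eqToHom h2.symm from Subsingleton.elim _ _]; infer_instance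
    exact (ConcreteCategory.bijective_of_isIso _).1
  have h4 : Function.Injective (Scheme.ΓSpecIso (.of L)).hom :=
    (ConcreteCategory.bijective_of_isIso _).1
  exact h4.comp (h3.comp h1)

/-- Over an affine open `U`, the elements of `L` integral over `Γ(X, U)` are sections of the
normalization. -/
theorem exists_normalizationSections_eq {U : X.Opens} (hUa : IsAffineOpen U) (hU : g ⁻¹ᵁ U = ⊤)
    {y : L} (hy : (evalSections g U hU).IsIntegralElem y) :
    ∃ x, normalizationSections g U hU x = y := by
  let := (g.app U).hom.toAlgebra
  have key := g.normalizationObjIso_hom_val hUa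
  let r : Γ(Spec (.of L), g ⁻¹ᵁ U) ⟶ Γ(Spec (.of L), ⊤) :=
    (Spec (.of L)).presheaf.map (homOfLE hU.ge).op
  have : IsIso (homOfLE hU.ge) := by
    rw [show homOfLE hU.ge = eqToHom hU.symm from Subsingleton.elim _ _]; infer_instance
  obtain ⟨y', hy'⟩ : ∃ y', (Scheme.ΓSpecIso (.of L)).hom (r y') = y :=
    (ConcreteCategory.bijective_of_isIso (r ≫ (Scheme.ΓSpecIso (.of L)).hom)).2 y
  have hinj : Function.Injective (r ≫ (Scheme.ΓSpecIso (.of L)).hom).hom :=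
    (ConcreteCategory.bijective_of_isIso (r ≫ (Scheme.ΓSpecIso (.of L)).hom)).1
  have hint : _root_.IsIntegral Γ(X, U) y' := by
    obtain ⟨p, hp, hp0⟩ := hy
    refine ⟨p, hp, hinj ?_⟩
    rw [Polynomial.hom_eval₂, map_zero]
    change p.eval₂ _ ((Scheme.ΓSpecIso (.of L)).hom (r y')) = 0
    rw [hy', ← hp0]
    congr 1
  obtain ⟨z, hz⟩ : ∃ z, (g.normalizationObjIso hUa).inv ⟨y', hint⟩ = z := ⟨_, rfl⟩
  refine ⟨z, ?_⟩
  have h1 := congr($key ((g.normalizationObjIso hUa).inv ⟨y', hint⟩))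
  rw [ConcreteCategory.comp_apply, Iso.inv_hom_id_apply] at h1
  rw [hz] at h1
  change y' = _ at h1
  rw [← hy', h1]
  change (Scheme.ΓSpecIso (.of L)).hom _ = (Scheme.ΓSpecIso (.of L)).hom _
  congr 1

end Normalization

/-- A `K`-scheme with a generic point `Spec L` for which `L` is regular over `K` is geometrically
integral: its base change to `E` has `Spec (L ⊗ E)` as a schematically dense subscheme. -/
theorem geometricallyIntegral_of_isSchemeTheoreticallyDominant {K L : Type u} [Field K] [Field L]
    [Algebra K L] {Y : Scheme.{u}} (s : Y ⟶ Spec (.of K)) (j : Spec (.of L) ⟶ Y) [QuasiCompact j]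
    [IsSchemeTheoreticallyDominant j]
    (hj : j ≫ s = Spec.map (CommRingCat.ofHom (algebraMap K L)))
    (hL : ∀ (E : Type u) [Field E] [Algebra K E], IsDomain (TensorProduct K L E)) :
    GeometricallyIntegral s := by
  refine ⟨geometrically_iff_of_commRing.mpr fun E _ _ Z fst snd hZ ↦ ?_⟩
  let t : Spec (.of E) ⟶ Spec (.of K) := Spec.map (CommRingCat.ofHom (algebraMap K E))
  have := hL E
  have h1 : IsIntegral (Limits.pullback (j ≫ s) t) := by
    rw [hj]
    exact IsIntegral.of_isIso (pullbackSpecIso K L E).inv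
  have h2 : IsIntegral (Limits.pullback j (Limits.pullback.fst s t)) :=
    IsIntegral.of_isIso (Limits.pullbackRightPullbackFstIso s t j).inv
  let q := Limits.pullback.snd j (Limits.pullback.fst s t)
  have hred : IsReduced (Limits.pullback s t) := IsSchemeTheoreticallyDominant.isReduced q
  have : IrreducibleSpace ↥(Limits.pullback s t) := by
    rw [irreducibleSpace_def]
    convert! ((IrreducibleSpace.isIrreducible_univ _).image _ q.continuous.continuousOn).closure
    simpa using q.denseRange.closure_range.symm
  have : IsIntegral (Limits.pullback s t) := isIntegral_of_irreducibleSpace_of_isReduced _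
  exact IsIntegral.of_isIso hZ.isoPullback.inv

theorem topologicalKrullDim_pos_of_surjective {X Y : Scheme.{u}} [IsIntegral Y] (f : Y ⟶ X)
    [Surjective f] (hX : 0 < topologicalKrullDim X) : 0 < topologicalKrullDim Y := by
  obtain ⟨S, T, hST⟩ := Order.krullDim_pos_iff.mp hX
  obtain ⟨x, hxT, hxS⟩ := Set.exists_of_ssubset (SetLike.coe_ssubset_coe.mpr hST)
  obtain ⟨x', hx'⟩ := S.2.nonempty
  obtain ⟨y, rfl⟩ := f.surjective x
  obtain ⟨y', rfl⟩ := f.surjective x'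
  have hne : y ≠ y' := fun h ↦ hxS (h ▸ hx')
  obtain ⟨z, hz⟩ : ∃ z, z ≠ genericPoint Y := by
    by_contra! h
    exact hne ((h y).trans (h y').symm)
  refine Order.krullDim_pos_iff.mpr
    ⟨⟨closure {z}, isIrreducible_singleton.closure, isClosed_closure⟩,
      ⟨Set.univ, IrreducibleSpace.isIrreducible_univ Y, isClosed_univ⟩, ?_⟩
  refine lt_of_le_of_ne (Set.subset_univ _) fun h ↦ hz ?_
  have h' : closure {z} = Set.univ := congrArg (fun s : TopologicalSpace.IrreducibleCloseds Y ↦ s.1) h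
  exact IsGenericPoint.eq h' (genericPoint_spec Y)

/-! ### The cover given by a regular extension of the function field -/

theorem exists_isAffineOpen_mem {Y : Scheme.{u}} (y : Y) :
    ∃ U : Y.Opens, IsAffineOpen U ∧ y ∈ U := by
  obtain ⟨U, hU, hy, -⟩ := Y.isBasis_affineOpens.exists_subset_of_mem_open
    (Set.mem_univ y) isOpen_univ
  obtain ⟨V, hV, rfl⟩ := hU
  exact ⟨V, hV, hy⟩

theorem evalSections_fromSpec {X : Scheme.{u}} {L : Type u} [Field L] {U : X.Opens}
    (hU : IsAffineOpen U) (φ : Γ(X, U) ⟶ .of L) (h) :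
    evalSections (Spec.map φ ≫ hU.fromSpec) U h = φ.hom := by
  have : (Spec.map φ ≫ hU.fromSpec).appLE U ⊤ h.ge ≫ (Scheme.ΓSpecIso (.of L)).hom = φ := by
    have hle : (⊤ : (Spec (.of L)).Opens) ≤ Spec.map φ ⁻¹ᵁ hU.fromSpec ⁻¹ᵁ U := h.ge
    have h1 : (Spec.map φ ≫ hU.fromSpec).appLE U ⊤ h.ge =
        hU.fromSpec.app U ≫ (Spec.map φ).appLE _ ⊤ hle := Scheme.Hom.comp_appLE _ _ _ _ _
    rw [h1, hU.fromSpec_app_self, Category.assoc, Category.assoc,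
      Scheme.Hom.map_appLE_assoc, Iso.inv_comp_eq]
    exact Scheme.ΓSpecIso_naturality φ
  exact congr($(this).hom)

section Variety

variable {K : Type u} [Field K]

/-- The generic point of `X` with values in an extension `L` of the function field. -/
def genericSpec (X : Variety K) (L : Type u) [Field L] [Algebra X.carrier.functionField L] :
    Spec (.of L) ⟶ X.carrier :=
  Spec.map (CommRingCat.ofHom (algebraMap X.carrier.functionField L)) ≫
    X.carrier.fromSpecStalk (genericPoint X.carrier)

variable (X : Variety K) (L : Type u) [Field L] [Algebra X.carrier.functionField L]

theorem genericSpec_eq {U : X.carrier.Opens} (hU : IsAffineOpen U) [Nonempty U] :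
    genericSpec X L = Spec.map (CommRingCat.ofHom ((algebraMap X.carrier.functionField L).comp
      (X.carrier.germToFunctionField U).hom)) ≫ hU.fromSpec := by
  rw [genericSpec, CommRingCat.ofHom_comp, Spec.map_comp, Category.assoc]
  congr 1
  exact (hU.fromSpecStalk_eq_fromSpecStalk _).symm

theorem genericSpec_apply (x : Spec (.of L)) : genericSpec X L x = genericPoint X.carrier := by
  have h : X.carrier.fromSpecStalk (genericPoint X.carrier)
      (Spec.map (CommRingCat.ofHom (algebraMap X.carrier.functionField L)) x) ∈
        Set.range (X.carrier.fromSpecStalk (genericPoint X.carrier)) := ⟨_, rfl⟩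
  rw [X.carrier.range_fromSpecStalk] at h
  exact (h.antisymm (genericPoint_specializes _)).eq

theorem genericSpec_preimage (U : X.carrier.Opens) [Nonempty U] : genericSpec X L ⁻¹ᵁ U = ⊤ := by
  refine TopologicalSpace.Opens.ext (Set.eq_univ_of_forall fun x ↦ ?_)
  change genericSpec X L x ∈ U
  rw [genericSpec_apply]
  exact ((genericPoint_spec X.carrier).mem_open_set_iff U.isOpen).mpr (by simpa using ‹Nonempty U›)

instance : IsDominant (genericSpec X L) := by
  obtain ⟨x⟩ : Nonempty (Spec (.of L)) := inferInstance
  rw [isDominant_iff, DenseRange, dense_iff_closure_eq, ← Set.univ_subset_iff]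
  exact (genericPoint_spec X.carrier).symm.subset.trans <|
    closure_mono (Set.singleton_subset_iff.mpr ⟨x, genericSpec_apply X L x⟩)

theorem evalSections_genericSpec {U : X.carrier.Opens} (hU : IsAffineOpen U) [Nonempty U] :
    evalSections (genericSpec X L) U (genericSpec_preimage X L U) =
      (algebraMap X.carrier.functionField L).comp (X.carrier.germToFunctionField U).hom := by
  have h := genericSpec_eq X L hU
  have h' := evalSections_fromSpec hU (CommRingCat.ofHom
    ((algebraMap X.carrier.functionField L).comp (X.carrier.germToFunctionField U).hom))
    (h ▸ genericSpec_preimage X L U)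
  simp only [← h] at h'
  exact h'

instance : QuasiSeparated X.str := by
  have := X.isVariety.isSeparated
  infer_instance

instance : QuasiCompact (genericSpec X L) :=
  quasiCompact_of_noetherianSpace_source _

instance : QuasiSeparated (genericSpec X L) := by
  have : QuasiSeparated (genericSpec X L ≫ X.str) := inferInstance
  exact .of_comp _ X.str

theorem germToFunctionField_fromSpec_finiteType {U : X.carrier.Opens} (hU : IsAffineOpen U) :
    (Spec.preimage (hU.fromSpec ≫ X.str)).hom.FiniteType := by
  have := X.isVariety.locallyOfFiniteType
  rw [← HasRingHomProperty.Spec_iff (P := @LocallyOfFiniteType), Spec.map_preimage]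
  infer_instance

/-- Sections of the normalization of `X` in `L` over an affine open `U` are the elements of `L`
integral over `Γ(X, U)`. -/
theorem exists_equiv_integralClosure {U : X.carrier.Opens} (hU : IsAffineOpen U) [Nonempty U]
    [Algebra Γ(X.carrier, U) L] [IsScalarTower Γ(X.carrier, U) X.carrier.functionField L] :
    ∃ ε : Γ((genericSpec X L).normalization, (genericSpec X L).fromNormalization ⁻¹ᵁ U) ≃+*
        integralClosure Γ(X.carrier, U) L,
      ∀ a, ε ((genericSpec X L).fromNormalization.app U a) = algebraMap _ _ a := by
  let g := genericSpec X L
  let hg := genericSpec_preimage X L U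
  have hev : evalSections g U hg = algebraMap Γ(X.carrier, U) L := by
    rw [evalSections_genericSpec X L hU]
    exact (IsScalarTower.algebraMap_eq Γ(X.carrier, U) X.carrier.functionField L).symm
  let e := normalizationSections g U hg
  have hcomp : e.comp (g.fromNormalization.app U).hom = algebraMap Γ(X.carrier, U) L := by
    rw [← hev]
    exact RingHom.ext (normalizationSections_app g U hg)
  have hint (x) : e x ∈ integralClosure Γ(X.carrier, U) L := by
    obtain ⟨p, hp, hp0⟩ := IsIntegralHom.isIntegral_app g.fromNormalization U hU x
    refine ⟨p, hp, ?_⟩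
    rw [← hcomp, ← Polynomial.hom_eval₂, hp0, map_zero]
  refine ⟨RingEquiv.ofBijective (e.codRestrict (integralClosure Γ(X.carrier, U) L).toSubring hint)
    ⟨fun x y h ↦ normalizationSections_injective g U hg congr($(h).1), fun ⟨y, hy⟩ ↦ ?_⟩,
      fun a ↦ Subtype.ext congr($hcomp a)⟩
  obtain ⟨x, hx⟩ := exists_normalizationSections_eq g hU hg (y := y) (by rw [hev]; exact hy)
  exact ⟨x, Subtype.ext hx⟩

variable [FiniteDimensional X.carrier.functionField L]

theorem isFinite_fromNormalization_genericSpec : IsFinite (genericSpec X L).fromNormalization := by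
  refine (isFinite_iff _).mpr ⟨inferInstance, fun U hU ↦ ?_⟩
  rcases isEmpty_or_nonempty U with hU0 | hU0
  · have : U = ⊥ := by
      ext x
      exact ⟨fun hx ↦ (hU0.false ⟨x, hx⟩).elim, fun hx ↦ hx.elim⟩
    subst this
    have : Subsingleton Γ((genericSpec X L).normalization, (genericSpec X L).fromNormalization ⁻¹ᵁ ⊥) :=
      inferInstanceAs (Subsingleton Γ((genericSpec X L).normalization, ⊥))
    let := ((genericSpec X L).fromNormalization.app ⊥).hom.toAlgebra
    exact Module.Finite.of_finite
  let : Algebra K Γ(X.carrier, U) := (Spec.preimage (hU.fromSpec ≫ X.str)).hom.toAlgebra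
  have : Algebra.FiniteType K Γ(X.carrier, U) := germToFunctionField_fromSpec_finiteType X hU
  let : Algebra Γ(X.carrier, U) L :=
    ((algebraMap X.carrier.functionField L).comp (algebraMap _ _)).toAlgebra
  have : IsScalarTower Γ(X.carrier, U) X.carrier.functionField L := .of_algebraMap_eq' rfl
  have := functionField_isFractionRing_of_isAffineOpen X.carrier U hU
  have := finite_integralClosure K (A := Γ(X.carrier, U)) X.carrier.functionField L
  obtain ⟨ε, hε⟩ := exists_equiv_integralClosure X L hU
  let := ((genericSpec X L).fromNormalization.app U).hom.toAlgebra
  let ε' : integralClosure Γ(X.carrier, U) L ≃ₐ[Γ(X.carrier, U)] Γ((genericSpec X L).normalization,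
      (genericSpec X L).fromNormalization ⁻¹ᵁ U) :=
    (AlgEquiv.ofRingEquiv (f := ε) hε).symm
  exact Module.Finite.equiv ε'.toLinearEquiv

theorem isNormal_normalization_genericSpec : IsNormal (genericSpec X L).normalization := by
  refine fun y ↦ ⟨inferInstance, ?_⟩
  obtain ⟨U, hU, hyU⟩ := exists_isAffineOpen_mem ((genericSpec X L).fromNormalization y)
  have : Nonempty U := ⟨⟨_, hyU⟩⟩
  have hW := hU.preimage (genericSpec X L).fromNormalization
  let : Algebra Γ(X.carrier, U) L :=
    ((algebraMap X.carrier.functionField L).comp (algebraMap _ _)).toAlgebra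
  have : IsScalarTower Γ(X.carrier, U) X.carrier.functionField L := .of_algebraMap_eq' rfl
  have := functionField_isFractionRing_of_isAffineOpen X.carrier U hU
  obtain ⟨ε, hε⟩ := exists_equiv_integralClosure X L hU
  have := integralClosure.isIntegrallyClosedOfFiniteExtension (R := Γ(X.carrier, U))
    X.carrier.functionField (L := L)
  have := IsIntegrallyClosed.of_equiv ε.symm
  have : IsDomain Γ((genericSpec X L).normalization, (genericSpec X L).fromNormalization ⁻¹ᵁ U) :=
    ε.toMulEquiv.isDomain _
  let : Algebra Γ((genericSpec X L).normalization, (genericSpec X L).fromNormalization ⁻¹ᵁ U)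
    ((genericSpec X L).normalization.presheaf.stalk y) :=
      TopCat.Presheaf.algebra_section_stalk _ (⟨y, hyU⟩ : (genericSpec X L).fromNormalization ⁻¹ᵁ U)
  have := hW.isLocalization_stalk ⟨y, hyU⟩
  exact isIntegrallyClosed_of_isLocalization _ _
    (hW.primeIdealOf ⟨y, hyU⟩).asIdeal.primeCompl_le_nonZeroDivisors

/-- The function field of the normalization of `X` in `L` is `L`. -/
theorem finrank_functionField_normalization_genericSpec [Surjective (genericSpec X L).fromNormalization] :
    let : Algebra X.carrier.functionField (genericSpec X L).normalization.functionField :=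
      (functionFieldMap (genericSpec X L).fromNormalization).hom.toAlgebra
    Module.finrank X.carrier.functionField (genericSpec X L).normalization.functionField =
      Module.finrank X.carrier.functionField L := by
  intro _
  obtain ⟨U, hU, hyU⟩ := exists_isAffineOpen_mem
    ((genericSpec X L).fromNormalization (genericPoint _))
  have : Nonempty U := ⟨⟨_, hyU⟩⟩
  let W := (genericSpec X L).fromNormalization ⁻¹ᵁ U
  have hW : IsAffineOpen W := hU.preimage (genericSpec X L).fromNormalization
  have : Nonempty W := ⟨⟨genericPoint _, hyU⟩⟩
  let : Algebra Γ(X.carrier, U) L :=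
    ((algebraMap X.carrier.functionField L).comp (algebraMap _ _)).toAlgebra
  have : IsScalarTower Γ(X.carrier, U) X.carrier.functionField L := .of_algebraMap_eq' rfl
  have := functionField_isFractionRing_of_isAffineOpen X.carrier U hU
  have := functionField_isFractionRing_of_isAffineOpen _ W hW
  obtain ⟨ε, hε⟩ := exists_equiv_integralClosure X L hU
  let : Algebra Γ((genericSpec X L).normalization, W) L :=
    ((algebraMap (integralClosure Γ(X.carrier, U) L) L).comp ε.toRingHom).toAlgebra
  have := integralClosure.isFractionRing_of_finite_extension (A := Γ(X.carrier, U))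
    X.carrier.functionField L
  have : IsFractionRing Γ((genericSpec X L).normalization, W) L := by
    have h := (IsLocalization.isLocalization_iff_of_base_ringEquiv
      (nonZeroDivisors (integralClosure Γ(X.carrier, U) L)) L ε.symm).mp inferInstance
    have hmap : (nonZeroDivisors (integralClosure Γ(X.carrier, U) L)).map ε.symm =
        nonZeroDivisors Γ((genericSpec X L).normalization, W) :=
      MulEquivClass.map_nonZeroDivisors ε.symm
    rw [hmap] at h
    exact h
  let j := (IsLocalization.algEquiv (nonZeroDivisors Γ((genericSpec X L).normalization, W))
    (genericSpec X L).normalization.functionField L).toRingEquiv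
  refine Algebra.finrank_eq_of_equiv_equiv (RingEquiv.refl _) j ?_
  refine IsLocalization.ringHom_ext (nonZeroDivisors Γ(X.carrier, U)) (RingHom.ext fun a ↦ ?_)
  have h1 : functionFieldMap (genericSpec X L).fromNormalization
      (X.carrier.germToFunctionField U a) =
      algebraMap Γ((genericSpec X L).normalization, W) (genericSpec X L).normalization.functionField
        ((genericSpec X L).fromNormalization.app U a) := by
    rw [functionFieldMap, ← ConcreteCategory.comp_apply, ← Category.assoc]
    erw [TopCat.Presheaf.germ_stalkSpecializes, Scheme.Hom.germ_stalkMap]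
    rfl
  change algebraMap _ L (algebraMap _ _ a) = j (functionFieldMap (genericSpec X L).fromNormalization
      (X.carrier.germToFunctionField U a))
  rw [h1]
  refine .trans ?_ (AlgEquiv.commutes _ _).symm
  exact congr((($(hε a)).1 : L)).symm

/-- A finite regular extension `L` of the function field of a variety `X` is the function field of a
cover, the normalization of `X` in `L`. -/
theorem exists_cover [Algebra K L]
    (hKL : genericSpec X L ≫ X.str = Spec.map (CommRingCat.ofHom (algebraMap K L)))
    (hL : ∀ (E : Type u) [Field E] [Algebra K E], IsDomain (TensorProduct K L E))
    (h1 : 1 < Module.finrank X.carrier.functionField L) :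
    ∃ φ : Cover X, 1 < φ.degree ∧ ∀ (U : X.carrier.Opens) (_ : IsAffineOpen U) [Nonempty U]
      [Algebra Γ(X.carrier, U) L] [IsScalarTower Γ(X.carrier, U) X.carrier.functionField L],
      ∃ ε : Γ(φ.source.carrier, φ.hom ⁻¹ᵁ U) →+* integralClosure Γ(X.carrier, U) L,
        ∀ a, ε (φ.hom.app U a) = algebraMap _ _ a := by
  let π := (genericSpec X L).fromNormalization
  have hfin : IsFinite π := isFinite_fromNormalization_genericSpec X L
  have hdom : IsDominant π := by
    have : IsDominant ((genericSpec X L).toNormalization ≫ π) := by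
      rw [(genericSpec X L).toNormalization_fromNormalization]; infer_instance
    exact .of_comp (genericSpec X L).toNormalization π
  have hsurj : Surjective π := surjective_of_isDominant_of_isClosed_range _ π.isClosedMap.isClosed_range
  have := X.isVariety.isSeparated
  have := X.isVariety.locallyOfFiniteType
  have := X.isVariety.quasiCompact
  let Y : Variety K :=
    { carrier := (genericSpec X L).normalization
      str := π ≫ X.str
      isVariety :=
        { isIntegral := inferInstance
          isSeparated := inferInstance
          locallyOfFiniteType := inferInstance
          quasiCompact := inferInstance
          dim_pos := topologicalKrullDim_pos_of_surjective π X.isVariety.dim_pos } }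
  have : IsSchemeTheoreticallyDominant (genericSpec X L).toNormalization :=
    ⟨(genericSpec X L).ker_toNormalization⟩
  let φ : Cover X :=
    { source := Y
      hom := π
      hom_str := rfl
      isFinite := hfin
      surjective := hsurj
      isNormal := isNormal_normalization_genericSpec X L
      geometricallyIntegral := geometricallyIntegral_of_isSchemeTheoreticallyDominant (L := L) _
        (genericSpec X L).toNormalization (by
          rw [← hKL, ← Category.assoc, (genericSpec X L).toNormalization_fromNormalization]) hL }
  refine ⟨φ, ?_, fun U hU _ _ _ ↦ ?_⟩
  · exact h1.trans_eq (finrank_functionField_normalization_genericSpec X L).symm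
  · obtain ⟨ε, hε⟩ := exists_equiv_integralClosure X L hU
    exact ⟨ε.toRingHom, hε⟩

end Variety

/-! ### Rational points that lift to an algebra of finite type -/

/-- A component of `Spec B` that dominates `Spec A` and along which `B` is quasi-finite over `A` is
generically finite over `Spec A`. -/
theorem isAlgebraic_quotient_of_quasiFiniteAt {A B : Type*} [CommRing A] [IsDomain A] [CommRing B]
    [Algebra A B] (p : Ideal B) [p.IsPrime] [Algebra.QuasiFiniteAt A p]
    (hinj : Function.Injective (algebraMap A (B ⧸ p))) : Algebra.IsAlgebraic A (B ⧸ p) := by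
  let Q := p.ResidueField
  have h1 : Algebra.QuasiFinite A Q := by
    refine .of_surjective_algHom (S := Localization.AtPrime p)
      (IsScalarTower.toAlgHom A (Localization.AtPrime p) Q) IsLocalRing.residue_surjective
  have hAQ : Function.Injective (algebraMap A Q) := by
    rw [IsScalarTower.algebraMap_eq A (B ⧸ p) Q]
    exact (IsFractionRing.injective (B ⧸ p) Q).comp hinj
  let F := FractionRing A
  let : Algebra F Q := (IsFractionRing.lift (K := F) hAQ).toAlgebra
  have : IsScalarTower A F Q := .of_algebraMap_eq fun x ↦
    (IsFractionRing.lift_algebraMap hAQ x).symm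
  have : Algebra.QuasiFinite F Q := .of_restrictScalars A F Q
  have : Module.Finite F Q := .of_quasiFinite
  have : Algebra.IsAlgebraic A Q := (IsFractionRing.comap_isAlgebraic_iff (K := F)).mpr inferInstance
  refine ⟨fun x ↦ ?_⟩
  rw [← isAlgebraic_algebraMap_iff (IsFractionRing.injective (B ⧸ p) Q)]
  exact Algebra.IsAlgebraic.isAlgebraic _

theorem quasiFiniteAt_of_isFinite_fiber {X Y : Scheme.{u}} (f : Y ⟶ X) [LocallyOfFiniteType f] (y : Y)
    [IsFinite (f.fiberToSpecResidueField (f y))] : f.QuasiFiniteAt y := by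
  rw [Scheme.Hom.quasiFiniteAt_iff_isOpen_singleton_asFiber]
  have : IsLocallyArtinian (f.fiber (f y)) := .of_locallyQuasiFinite (f.fiberToSpecResidueField (f y))
  exact isOpen_discrete _

/-- A morphism with finite fibre over the generic point is quasi-finite at the points of this fibre. -/
theorem quasiFiniteAt_appLE {X Y : Scheme.{u}} [IsIntegral X] (f : Y ⟶ X) [LocallyOfFiniteType f]
    (hf : ∀ η : X, IsGenericPoint η Set.univ → IsFinite (f.fiberToSpecResidueField η))
    {U : X.Opens} (hU : IsAffineOpen U) {V : Y.Opens} (hV : IsAffineOpen V) (hVU : V ≤ f ⁻¹ᵁ U)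
    (p : Ideal Γ(Y, V)) [p.IsPrime] (hp : p.comap (f.appLE U V hVU).hom = ⊥) :
    (f.appLE U V hVU).hom.QuasiFiniteAt p := by
  let x : Spec Γ(Y, V) := (⟨p, ‹_›⟩ : PrimeSpectrum Γ(Y, V))
  have hxV : hV.fromSpec x ∈ V := by
    have : hV.fromSpec x ∈ Set.range hV.fromSpec := ⟨x, rfl⟩
    rwa [hV.range_fromSpec] at this
  have : Nonempty U := ⟨⟨_, hVU hxV⟩⟩
  have h1 : f (hV.fromSpec x) = genericPoint X := by
    rw [← Scheme.Hom.comp_apply, ← IsAffineOpen.SpecMap_appLE_fromSpec f hU hV hVU,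
      Scheme.Hom.comp_apply, ← genericPoint_eq_of_isOpenImmersion hU.fromSpec,
      genericPoint_eq_bot_of_affine]
    congr 1
    exact PrimeSpectrum.ext hp
  have : IsFinite (f.fiberToSpecResidueField (f (hV.fromSpec x))) :=
    hf _ (h1 ▸ genericPoint_spec X)
  have h2 := (quasiFiniteAt_of_isFinite_fiber f (hV.fromSpec x)).quasiFiniteAt hV hU hVU hxV
  have h3 : hV.primeIdealOf ⟨hV.fromSpec x, hxV⟩ = x :=
    hV.fromSpec.isOpenEmbedding.injective (hV.fromSpec_primeIdealOf _)
  simp only [h3] at h2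
  exact h2

section IsCovered

variable {K : Type u} [Field K]

/-- A set `T` of `K`-points of an affine open `U` of `X` is covered if, up to a proper closed subset
of `U`, its points lift to one of finitely many covers of `X` of degree greater than one. -/
def IsCovered (X : Variety K) (U : X.carrier.Opens) (T : Set (Γ(X.carrier, U) →+* K)) : Prop :=
  ∃ g : Γ(X.carrier, U), g ≠ 0 ∧ ∃ (ι : Type) (_ : Finite ι) (φ : ι → Cover X),
    (∀ i, 1 < (φ i).degree) ∧ ∀ a ∈ T, a g ≠ 0 → ∃ i,
      ∃ c : Γ((φ i).source.carrier, (φ i).hom ⁻¹ᵁ U) →+* K, c.comp ((φ i).hom.app U).hom = a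

theorem IsCovered.mono {X : Variety K} {U : X.carrier.Opens} {S T : Set (Γ(X.carrier, U) →+* K)}
    (hT : IsCovered X U T) (hST : S ⊆ T) : IsCovered X U S := by
  obtain ⟨g, hg, ι, hι, φ, hφ, h⟩ := hT
  exact ⟨g, hg, ι, hι, φ, hφ, fun a ha ↦ h a (hST ha)⟩

theorem IsCovered.iUnion {X : Variety K} {U : X.carrier.Opens} [Nonempty U] {κ : Type*} [Finite κ]
    {T : κ → Set (Γ(X.carrier, U) →+* K)} (hT : ∀ k, IsCovered X U (T k)) :
    IsCovered X U (⋃ k, T k) := by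
  obtain ⟨n, ⟨e⟩⟩ := Finite.exists_equiv_fin κ
  choose g hg ι hι φ hφ h using hT
  have := Fintype.ofFinite κ
  refine ⟨∏ k, g k, Finset.prod_ne_zero_iff.mpr fun k _ ↦ hg k, Σ k : Fin n, ι (e.symm k),
    inferInstance, fun i ↦ φ _ i.2, fun i ↦ hφ _ _, fun a ha hag ↦ ?_⟩
  obtain ⟨k, hk⟩ := Set.mem_iUnion.mp ha
  rw [map_prod] at hag
  obtain ⟨i, c, hc⟩ := h k a hk (Finset.prod_ne_zero_iff.mp hag k (Finset.mem_univ k))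
  obtain ⟨j, rfl⟩ := e.symm.surjective k
  exact ⟨⟨j, i⟩, c, hc⟩

/-- The set of `K`-points of `Spec A`, given by ring homomorphisms `A → K` that are the identity on
`K`, that lift to the `A`-algebra `B`. -/
def liftablePoints (K A B : Type*) [CommRing K] [CommRing A] [CommRing B] [Algebra K A] [Algebra A B] :
    Set (A →+* K) :=
  {a | a.comp (algebraMap K A) = RingHom.id K ∧ ∃ b : B →+* K, b.comp (algebraMap A B) = a}

/-- The points of `U` that lift to a generically finite affine integral scheme over `U` without a
rational section are covered, by the normalization of `X` in its function field or by nothing. -/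
theorem isCovered_of_isDomain (X : Variety K) {U : X.carrier.Opens} (hU : IsAffineOpen U)
    [Nonempty U] [Algebra K Γ(X.carrier, U)]
    (hK : Spec.map (CommRingCat.ofHom (algebraMap K Γ(X.carrier, U))) = hU.fromSpec ≫ X.str)
    (D : Type u) [CommRing D] [IsDomain D] [Algebra Γ(X.carrier, U) D]
    [Algebra.FiniteType Γ(X.carrier, U) D]
    (hfin : Function.Injective (algebraMap Γ(X.carrier, U) D) →
      Algebra.IsAlgebraic Γ(X.carrier, U) D)
    (hD : IsEmpty (D →ₐ[Γ(X.carrier, U)] X.carrier.functionField)) :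
    IsCovered X U (liftablePoints K Γ(X.carrier, U) D) := by
  have : Algebra.FiniteType K Γ(X.carrier, U) := by
    have h := germToFunctionField_fromSpec_finiteType X hU
    rw [← hK, Spec.preimage_map] at h
    exact RingHom.finiteType_algebraMap.mp h
  have := functionField_isFractionRing_of_isAffineOpen X.carrier U hU
  obtain ⟨g, hg, h⟩ := exists_regular_extension (K := K) X.carrier.functionField D hfin hD
  rcases h with h | ⟨L, _, _, _, _, _, _, _, h1, hE, hL⟩
  · refine ⟨g, hg, Empty, inferInstance, Empty.elim, fun i ↦ i.elim, fun a ⟨haK, d, hd⟩ hag ↦ ?_⟩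
    exact (hag (h { a with commutes' := fun c ↦ congr($haK c) } d hd)).elim
  · have hKL : genericSpec X L ≫ X.str = Spec.map (CommRingCat.ofHom (algebraMap K L)) := by
      rw [genericSpec_eq X L hU, Category.assoc, ← hK, ← Spec.map_comp]
      congr 1
      ext c
      change algebraMap _ L (algebraMap _ X.carrier.functionField (algebraMap K Γ(X.carrier, U) c)) = _
      rw [← IsScalarTower.algebraMap_apply, ← IsScalarTower.algebraMap_apply]
      rfl
    obtain ⟨φ, hφ, h⟩ := exists_cover X L hKL hE h1
    obtain ⟨ε, hε⟩ := h U hU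
    refine ⟨g, hg, Unit, inferInstance, fun _ ↦ φ, fun _ ↦ hφ, fun a ⟨haK, d, hd⟩ hag ↦ ⟨(), ?_⟩⟩
    obtain ⟨c, hc⟩ := hL { a with commutes' := fun c ↦ congr($haK c) } d hd hag
    refine ⟨c.comp ε, RingHom.ext fun x ↦ ?_⟩
    have : c (algebraMap _ _ x) = a x := congr($hc x)
    rw [← this, ← hε]
    rfl

/-- The points of `U` that lift to an affine scheme over `U` which is of finite type, generically finite
and without a rational section are covered: consider its irreducible components. -/
theorem isCovered_of_finiteType (X : Variety K) {U : X.carrier.Opens} (hU : IsAffineOpen U)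
    [Nonempty U] [Algebra K Γ(X.carrier, U)]
    (hK : Spec.map (CommRingCat.ofHom (algebraMap K Γ(X.carrier, U))) = hU.fromSpec ≫ X.str)
    (B : Type u) [CommRing B] [Algebra Γ(X.carrier, U) B]
    [Algebra.FiniteType Γ(X.carrier, U) B]
    (hfin : ∀ (p : Ideal B) [p.IsPrime], Function.Injective (algebraMap Γ(X.carrier, U) (B ⧸ p)) →
      Algebra.IsAlgebraic Γ(X.carrier, U) (B ⧸ p))
    (hB : IsEmpty (B →ₐ[Γ(X.carrier, U)] X.carrier.functionField)) :
    IsCovered X U (liftablePoints K Γ(X.carrier, U) B) := by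
  have : Algebra.FiniteType K Γ(X.carrier, U) := by
    have h := germToFunctionField_fromSpec_finiteType X hU
    rw [← hK, Spec.preimage_map] at h
    exact RingHom.finiteType_algebraMap.mp h
  have : IsNoetherianRing Γ(X.carrier, U) := Algebra.FiniteType.isNoetherianRing K _
  have : IsNoetherianRing B := Algebra.FiniteType.isNoetherianRing Γ(X.carrier, U) _
  have : Finite (minimalPrimes B) := (minimalPrimes.finite_of_isNoetherianRing B).to_subtype
  have hp (p : minimalPrimes B) : p.1.IsPrime := p.2.1.1
  refine (IsCovered.iUnion (κ := minimalPrimes B)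
    (T := fun p ↦ liftablePoints K Γ(X.carrier, U) (B ⧸ p.1)) fun p ↦ ?_).mono ?_
  · refine isCovered_of_isDomain X hU hK _ (hfin p.1) ⟨fun φ ↦ hB.false ?_⟩
    exact φ.comp (Ideal.Quotient.mkₐ _ _)
  · rintro a ⟨ha, b, hb⟩
    have : (RingHom.ker b).IsPrime := RingHom.ker_isPrime b
    obtain ⟨p, hp, hpb⟩ := Ideal.exists_minimalPrimes_le (I := ⊥) (J := RingHom.ker b) bot_le
    refine Set.mem_iUnion.mpr ⟨⟨p, hp⟩, ha, Ideal.Quotient.lift p b fun x hx ↦ hpb hx, ?_⟩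
    rw [← hb]
    rfl

end IsCovered

/-! ### The standard chart of projective space -/

section Chart

open MvPolynomial HomogeneousLocalization

attribute [local instance] MvPolynomial.gradedAlgebra

theorem aeval_mul_of_isHomogeneous {σ R S : Type*} [CommSemiring R] [CommSemiring S] [Algebra R S]
    {p : MvPolynomial σ R} {m : ℕ} (hp : p.IsHomogeneous m) (c : S) (v : σ → S) :
    aeval (fun i ↦ c * v i) p = c ^ m * aeval v p := by
  rw [aeval_def, aeval_def, eval₂_eq, eval₂_eq, Finset.mul_sum]
  refine Finset.sum_congr rfl fun d hd ↦ ?_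
  have hd' : ∑ i ∈ d.support, d i = m := hp.degree_eq_sum_deg_support hd |>.symm
  simp_rw [mul_pow, Finset.prod_mul_distrib, Finset.prod_pow_eq_pow_sum, hd']
  ring

variable (n : ℕ) (K : Type u) [Field K]

theorem X_mem_homogeneousSubmodule (i : Fin (n + 1)) :
    (X i : MvPolynomial (Fin (n + 1)) K) ∈ homogeneousSubmodule (Fin (n + 1)) K 1 :=
  isHomogeneous_X K i

/-- The homogeneous coordinate ring of `ℙⁿ` localized at `x₀`, in degree zero. -/
abbrev chartRing : Type u :=
  Away (homogeneousSubmodule (Fin (n + 1)) K) (X 0 : MvPolynomial (Fin (n + 1)) K)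

/-- The constants in the coordinate ring of the chart `x₀ ≠ 0`. -/
def chartConst : K →+* chartRing n K :=
  (fromZeroRingHom (homogeneousSubmodule (Fin (n + 1)) K) _).comp
    (algebraMap K (homogeneousSubmodule (Fin (n + 1)) K 0))

/-- The coordinate `xᵢ / x₀` on the chart `x₀ ≠ 0`. -/
def chartCoord (i : Fin n) : chartRing n K :=
  Away.mk (homogeneousSubmodule (Fin (n + 1)) K) (X_mem_homogeneousSubmodule n K 0) 1 (X i.succ)
    (by simpa using X_mem_homogeneousSubmodule n K i.succ)

/-- Polynomials in the affine coordinates, as functions on the chart `x₀ ≠ 0`. -/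
def toChart : MvPolynomial (Fin n) K →+* chartRing n K :=
  eval₂Hom (chartConst n K) (chartCoord n K)

/-- Dehomogenization. -/
def ofChart : chartRing n K →+* MvPolynomial (Fin n) K :=
  (IsLocalization.Away.lift (X 0 : MvPolynomial (Fin (n + 1)) K)
    (g := (aeval (Fin.cons 1 X : Fin (n + 1) → MvPolynomial (Fin n) K)).toRingHom)
    (by simp)).comp (algebraMap (chartRing n K)
      (Localization.Away (X 0 : MvPolynomial (Fin (n + 1)) K)))

theorem val_chartConst (c : K) : (chartConst n K c).val = algebraMap (MvPolynomial (Fin (n + 1)) K)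
    (Localization.Away (X 0 : MvPolynomial (Fin (n + 1)) K)) (C c) := by
  rw [← Localization.mk_one_eq_algebraMap]
  rfl

theorem ofChart_mk (m : ℕ) (a : MvPolynomial (Fin (n + 1)) K) (ha) :
    ofChart n K (Away.mk (homogeneousSubmodule (Fin (n + 1)) K)
      (X_mem_homogeneousSubmodule n K 0) m a ha) =
      aeval (Fin.cons 1 X : Fin (n + 1) → MvPolynomial (Fin n) K) a := by
  rw [ofChart, RingHom.comp_apply]
  change IsLocalization.Away.lift _ _
    (Away.mk _ (X_mem_homogeneousSubmodule n K 0) m a ha).val = _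
  rw [Away.val_mk, Localization.mk_eq_mk', IsLocalization.Away.lift, IsLocalization.lift_mk'_spec]
  simp

theorem val_toChart (p : MvPolynomial (Fin n) K) :
    (toChart n K p).val = aeval (fun i : Fin n ↦ Localization.mk (X i.succ : MvPolynomial (Fin (n + 1)) K)
      ⟨X 0, Submonoid.mem_powers _⟩) p := by
  have h : (algebraMap (chartRing n K) (Localization.Away (X 0 : MvPolynomial (Fin (n + 1)) K))).comp
      (toChart n K) = (aeval (fun i : Fin n ↦ Localization.mk (X i.succ : MvPolynomial (Fin (n + 1)) K)
        ⟨X 0, Submonoid.mem_powers _⟩)).toRingHom := by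
    refine MvPolynomial.ringHom_ext (fun c ↦ ?_) fun i ↦ ?_
    · rw [RingHom.comp_apply, toChart, eval₂Hom_C, AlgHom.toRingHom_eq_coe, RingHom.coe_coe, algHom_C]
      rfl
    · rw [RingHom.comp_apply, toChart, coe_eval₂Hom, eval₂_X, AlgHom.toRingHom_eq_coe, RingHom.coe_coe,
        aeval_X]
      change (chartCoord n K i).val = _
      rw [chartCoord, Away.val_mk]
      congr 1
      simp
  exact congr($h p)

/-- The class of `a / x₀ ^ m`, with `a` homogeneous of degree `m`, is `a (1, x₁ / x₀, …, xₙ / x₀)`. -/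
theorem toChart_ofChart (z : chartRing n K) : toChart n K (ofChart n K z) = z := by
  obtain ⟨m, a, ha, rfl⟩ := Away.mk_surjective _ (X_mem_homogeneousSubmodule n K 0) z
  refine val_injective _ ?_
  rw [ofChart_mk, val_toChart]
  refine .trans ?_ (Away.val_mk (𝒜 := homogeneousSubmodule (Fin (n + 1)) K) m
    (X_mem_homogeneousSubmodule n K 0) a ha).symm
  let L := Localization.Away (X 0 : MvPolynomial (Fin (n + 1)) K)
  let v : Fin n → L := fun i ↦ Localization.mk (X i.succ) ⟨X 0, Submonoid.mem_powers _⟩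
  let w : Fin (n + 1) → L := Fin.cons 1 v
  have h1 : aeval v (aeval (Fin.cons 1 X : Fin (n + 1) → MvPolynomial (Fin n) K) a) = aeval w a := by
    rw [← AlgHom.comp_apply]
    congr 1
    ext i
    rw [AlgHom.comp_apply, aeval_X, aeval_X]
    refine Fin.cases ?_ (fun j ↦ ?_) i <;> simp [w]
  have h2 : (fun i : Fin (n + 1) ↦ algebraMap (MvPolynomial (Fin (n + 1)) K) L (X 0) * w i) =
      fun i ↦ algebraMap (MvPolynomial (Fin (n + 1)) K) L (X i) := by
    funext i
    refine Fin.cases ?_ (fun j ↦ ?_) i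
    · simp [w]
    · simp only [w, v, Fin.cons_succ, Localization.mk_eq_mk']
      exact IsLocalization.mk'_spec' L (X j.succ : MvPolynomial (Fin (n + 1)) K)
        (⟨X 0, Submonoid.mem_powers _⟩ : Submonoid.powers (X 0 : MvPolynomial (Fin (n + 1)) K))
  have ha' : a.IsHomogeneous m := by simpa using ha
  have h3 := aeval_mul_of_isHomogeneous ha' (algebraMap (MvPolynomial (Fin (n + 1)) K) L (X 0)) w
  have h4 : aeval (fun i ↦ algebraMap (MvPolynomial (Fin (n + 1)) K) L (X i)) a = algebraMap _ L a :=
    congr($(aeval_unique (IsScalarTower.toAlgHom K (MvPolynomial (Fin (n + 1)) K) L)) a).symm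
  rw [h2, h4] at h3
  change aeval v _ = _
  rw [h1, Localization.mk_eq_mk', IsLocalization.eq_mk'_iff_mul_eq, mul_comm, h3, map_pow]

theorem ofChart_toChart (p : MvPolynomial (Fin n) K) : ofChart n K (toChart n K p) = p := by
  rw [← RingHom.comp_apply]
  nth_rw 2 [← RingHom.id_apply p]
  congr 1
  refine MvPolynomial.ringHom_ext (fun c ↦ ?_) fun i ↦ ?_
  · rw [RingHom.comp_apply, toChart, eval₂Hom_C, ofChart, RingHom.comp_apply]
    change IsLocalization.Away.lift _ _ (chartConst n K c).val = _
    rw [val_chartConst, IsLocalization.Away.lift_eq]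
    simp
  · simp only [RingHom.comp_apply, toChart, coe_eval₂Hom, eval₂_X]
    rw [chartCoord, ofChart_mk]
    simp

/-- The coordinate ring of the chart `x₀ ≠ 0` of `ℙⁿ` is a polynomial ring. -/
def chartEquiv : MvPolynomial (Fin n) K ≃+* chartRing n K :=
  .ofRingHom (toChart n K) (ofChart n K) (RingHom.ext (toChart_ofChart n K))
    (RingHom.ext (ofChart_toChart n K))

/-- The chart `𝔸ⁿ ⟶ ℙⁿ` with image `x₀ ≠ 0`, with the definition of `ℙⁿ` unfolded. -/
def projChart : Spec (.of (MvPolynomial (Fin n) K)) ⟶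
    Proj (homogeneousSubmodule (Fin (n + 1)) K) :=
  Spec.map (CommRingCat.ofHom (ofChart n K)) ≫
    Proj.awayι (homogeneousSubmodule (Fin (n + 1)) K) (X 0) (X_mem_homogeneousSubmodule n K 0) one_pos

instance : IsOpenImmersion (projChart n K) := by
  have : IsIso (CommRingCat.ofHom (ofChart n K)) :=
    inferInstanceAs (IsIso (chartEquiv n K).symm.toCommRingCatIso.hom)
  exact IsOpenImmersion.comp _ _

/-- The chart `𝔸ⁿ ⟶ ℙⁿ` with image `x₀ ≠ 0`. -/
def chart : Spec (.of (MvPolynomial (Fin n) K)) ⟶ projectiveSpace n K :=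
  projChart n K

instance : IsOpenImmersion (chart n K) :=
  inferInstanceAs (IsOpenImmersion (projChart n K))

theorem chart_str : chart n K ≫ projectiveSpaceStr n K =
    Spec.map (CommRingCat.ofHom (algebraMap K (MvPolynomial (Fin n) K))) := by
  change projChart n K ≫ Proj.toSpecZero (homogeneousSubmodule (Fin (n + 1)) K) ≫
    Spec.map (CommRingCat.ofHom (algebraMap K (homogeneousSubmodule (Fin (n + 1)) K 0))) = _
  rw [projChart, Category.assoc, Proj.awayι_toSpecZero_assoc]
  rw [← Spec.map_comp, ← Spec.map_comp, ← CommRingCat.ofHom_comp, ← CommRingCat.ofHom_comp]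
  congr 2
  have : algebraMap K (MvPolynomial (Fin n) K) =
      (ofChart n K).comp ((toChart n K).comp C) := RingHom.ext fun c ↦ (ofChart_toChart n K (C c)).symm
  rw [this]
  congr 1
  refine RingHom.ext fun c ↦ ?_
  change _ = eval₂Hom (chartConst n K) (chartCoord n K) (C c)
  rw [eval₂Hom_C]
  rfl

end Chart

/-! ### Rational sections, and charts of rational varieties -/

theorem fromSpecStalk_genericPoint_eq (C : Scheme.{u}) [IsIntegral C] {W : C.Opens} (hW : IsAffineOpen W)
    [Nonempty W] : C.fromSpecStalk (genericPoint C) =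
      Spec.map (C.germToFunctionField W) ≫ hW.fromSpec := by
  rw [← hW.fromSpecStalk_eq_fromSpecStalk
    (((genericPoint_spec C).mem_open_set_iff W.isOpen).mpr (by simpa using ‹Nonempty W›))]
  rfl

/-- A rational section of `f` along `i : C ⟶ X` can be given in affine charts, by its value at the generic
point of `C`: it spreads out, since `f` is locally of finite type. -/
theorem hasRationalSectionAlong_of_ringHom {X Y C : Scheme.{u}} [IsIntegral C] (i : C ⟶ X) (f : Y ⟶ X)
    [LocallyOfFiniteType f] {U : X.Opens} (hU : IsAffineOpen U) {V : Y.Opens} (hV : IsAffineOpen V)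
    {W : C.Opens} (hW : IsAffineOpen W) [Nonempty W] (hVU : V ≤ f ⁻¹ᵁ U) (hWU : W ≤ i ⁻¹ᵁ U)
    (e : Γ(Y, V) →+* C.functionField)
    (he : e.comp (f.appLE U V hVU).hom =
      (C.germToFunctionField W).hom.comp (i.appLE U W hWU).hom) :
    HasRationalSectionAlong i f := by
  have h : (Spec.map (CommRingCat.ofHom e) ≫ hV.fromSpec) ≫ f =
      C.fromSpecStalk (genericPoint C) ≫ i := by
    rw [fromSpecStalk_genericPoint_eq C hW, Category.assoc, Category.assoc,
      ← IsAffineOpen.SpecMap_appLE_fromSpec f hU hV hVU,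
      ← IsAffineOpen.SpecMap_appLE_fromSpec i hU hW hWU, ← Spec.map_comp_assoc, ← Spec.map_comp_assoc]
    congr 2
    exact CommRingCat.hom_ext he
  exact ⟨.ofFromSpecStalk i f _ h, Scheme.PartialMap.ofFromSpecStalk_comp i f _ h⟩

theorem HasRationalSectionAlong.hasRationalSection {X Y : Scheme.{u}} {f : Y ⟶ X}
    (h : HasRationalSectionAlong (𝟙 X) f) : HasRationalSection f := by
  obtain ⟨ψ, hψ⟩ := h
  exact ⟨ψ, by rw [hψ, Category.comp_id]⟩

/-- A nonempty open subset of a rational variety contains a nonempty affine open subset isomorphic to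
a principal open subset of an affine space. -/
theorem exists_isOpenImmersion_of_isRational {K : Type u} [Field K] {C : Variety K}
    (h : C.IsRational) (G : C.carrier.Opens) (hG : (G : Set C.carrier).Nonempty) :
    ∃ (n : ℕ) (g : MvPolynomial (Fin n) K), g ≠ 0 ∧
      ∃ k : Spec (.of (Localization.Away g)) ⟶ C.carrier, IsOpenImmersion k ∧ Set.range k ⊆ G ∧
        k ≫ C.str = Spec.map (CommRingCat.ofHom (algebraMap K (Localization.Away g))) := by
  obtain ⟨n, e, he⟩ := h
  -- a point of `G` that corresponds to a point of the chart
  obtain ⟨s, hsG, z, hz⟩ : ∃ s : e.source.toScheme, e.source.ι s ∈ G ∧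
      ∃ z, chart n K z = e.target.ι (e.iso.hom s) := by
    obtain ⟨y, hy, hy'⟩ := e.dense_target.inter_open_nonempty _ (chart n K).opensRange.isOpen
      ⟨_, Set.mem_range_self (f := chart n K)
        (Classical.arbitrary (PrimeSpectrum (MvPolynomial (Fin n) K)))⟩
    let O : C.carrier.Opens := e.source.ι ''ᵁ (e.iso.hom ⁻¹ᵁ (e.target.ι ⁻¹ᵁ (chart n K).opensRange))
    have hO : (O : Set C.carrier).Nonempty := by
      let y' : e.target.toScheme := ⟨y, hy'⟩
      refine ⟨e.source.ι (e.iso.inv y'), _, ?_, rfl⟩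
      change e.target.ι (e.iso.hom (e.iso.inv y')) ∈ (chart n K).opensRange
      rw [Scheme.inv_hom_apply]
      exact hy
    obtain ⟨_, ⟨s, ⟨z, hz⟩, rfl⟩, hG⟩ :=
      PreirreducibleSpace.isPreirreducible_univ (X := C.carrier) O G O.isOpen G.isOpen
        (by simpa using hO) (by simpa using hG) |>.imp fun _ ↦ And.right
    exact ⟨s, hG, z, hz⟩
  let O : (Spec (.of (MvPolynomial (Fin n) K))).Opens :=
    chart n K ⁻¹ᵁ (e.target.ι ''ᵁ (e.iso.inv ⁻¹ᵁ (e.source.ι ⁻¹ᵁ G)))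
  have hO : z ∈ O := by
    refine ⟨e.iso.hom s, ?_, hz.symm⟩
    change e.source.ι (e.iso.inv (e.iso.hom s)) ∈ G
    rw [Scheme.hom_inv_apply]
    exact hsG
  obtain ⟨_, ⟨_, ⟨g, rfl⟩, rfl⟩, hzg, hgO⟩ :=
    PrimeSpectrum.isBasis_basic_opens.exists_subset_of_mem_open hO O.isOpen
  refine ⟨n, g, ?_, ?_⟩
  · rintro rfl
    exact hzg (Ideal.zero_mem _)
  let j : Spec (.of (Localization.Away g)) ⟶ Spec (.of (MvPolynomial (Fin n) K)) :=
    Spec.map (CommRingCat.ofHom (algebraMap _ _))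
  have hj (p) : j p ∈ O := by
    refine hgO ?_
    have : j p ∈ Set.range (PrimeSpectrum.comap (algebraMap _ (Localization.Away g))) := ⟨p, rfl⟩
    rwa [PrimeSpectrum.localization_away_comap_range _ g] at this
  have : IsOpenImmersion j := inferInstanceAs (IsOpenImmersion (Spec.map (CommRingCat.ofHom
    (algebraMap (MvPolynomial (Fin n) K) (Localization.Away g)))))
  have hr : Set.range (j ≫ chart n K) ⊆ Set.range e.target.ι := by
    rintro _ ⟨p, rfl⟩
    obtain ⟨t, -, ht⟩ := hj p
    exact ⟨t, ht⟩
  let l := IsOpenImmersion.lift e.target.ι (j ≫ chart n K) hr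
  have hl : l ≫ e.target.ι = j ≫ chart n K := IsOpenImmersion.lift_fac _ _ _
  have : IsOpenImmersion l := by
    have : IsOpenImmersion (l ≫ e.target.ι) := by rw [hl]; infer_instance
    exact IsOpenImmersion.of_comp l e.target.ι
  refine ⟨l ≫ e.iso.inv ≫ e.source.ι, inferInstance, ?_, ?_⟩
  · rintro _ ⟨p, rfl⟩
    obtain ⟨t, ht, ht'⟩ := hj p
    have : l p = t := e.target.ι.injective (by
      refine .trans ?_ ht'.symm
      rw [← Scheme.Hom.comp_apply, hl]
      rfl)
    change e.source.ι (e.iso.inv (l p)) ∈ G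
    rw [this]
    exact ht
  · have he' : e.iso.inv ≫ e.source.ι ≫ C.str = e.target.ι ≫ projectiveSpaceStr n K := by
      rw [Iso.inv_comp_eq]
      exact Eq.symm he
    rw [Category.assoc, Category.assoc, he', reassoc_of% hl, chart_str, ← Spec.map_comp,
      ← CommRingCat.ofHom_comp, ← IsScalarTower.algebraMap_eq]

/-- A nonempty open subset of a rational variety over a Hilbertian field contains a nonempty affine open
subset with the Hilbert property. -/
theorem exists_algHP_of_isRational {K : Type u} [Field K] (hK : AlgHP K (Polynomial K)) {C : Variety K}
    (h : C.IsRational) (G : C.carrier.Opens) (hG : (G : Set C.carrier).Nonempty) :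
    ∃ (W : C.carrier.Opens) (hW : IsAffineOpen W) (_ : Nonempty W), W ≤ G ∧
      ∀ [Algebra K Γ(C.carrier, W)], Spec.map (CommRingCat.ofHom (algebraMap K Γ(C.carrier, W))) =
        hW.fromSpec ≫ C.str → AlgHP K Γ(C.carrier, W) := by
  obtain ⟨n, g, hg, k, hk, hkG, hkK⟩ := exists_isOpenImmersion_of_isRational h G hG
  have : IsDomain (Localization.Away g) := IsLocalization.isDomain_localization
    (powers_le_nonZeroDivisors_of_noZeroDivisors hg)
  have hR : AlgHP K (Localization.Away g) := (AlgHP.mvPolynomial hK n).away (Localization.Away g) hg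
  have hne : Nonempty (Spec (.of (Localization.Away g))) :=
    inferInstanceAs (Nonempty (PrimeSpectrum (Localization.Away g)))
  have hW := isAffineOpen_opensRange k
  have : Nonempty k.opensRange := ⟨⟨k hne.some, Set.mem_range_self _⟩⟩
  refine ⟨k.opensRange, hW, this, hkG, fun hKW ↦ ?_⟩
  let i := IsOpenImmersion.isoOfRangeEq k hW.fromSpec (by simp)
  have hi : i.hom ≫ hW.fromSpec = k := IsOpenImmersion.isoOfRangeEq_hom_fac _ _ _
  let ρ : Γ(C.carrier, k.opensRange) ⟶ .of (Localization.Away g) := Spec.preimage i.hom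
  have hρ : Spec.map ρ = i.hom := Spec.map_preimage _
  have : IsIso ρ := by
    have : IsIso (Scheme.Spec.map ρ.op) := by
      change IsIso (Spec.map ρ)
      rw [hρ]
      infer_instance
    have := isIso_of_reflects_iso ρ.op Scheme.Spec
    exact isIso_of_op ρ
  let r : Γ(C.carrier, k.opensRange) ≃+* Localization.Away g :=
    .ofBijective ρ.hom (ConcreteCategory.bijective_of_isIso ρ)
  have hr : CommRingCat.ofHom (algebraMap K Γ(C.carrier, k.opensRange)) ≫ ρ =
      CommRingCat.ofHom (algebraMap K (Localization.Away g)) := by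
    refine Spec.map_injective ?_
    rw [Spec.map_comp, hρ, hKW, reassoc_of% hi, hkK]
  exact AlgHP.of_algEquiv hR (AlgEquiv.ofRingEquiv (f := r) fun c ↦ congr($hr c)).symm

/-! ### Rational points of a rational subvariety, and of a thin set -/

open scoped TensorProduct

/-- A rational subvariety without a rational section along any of finitely many covers has a `K`-point,
in a given nonempty open subset, that does not lift to any of the covers. -/
theorem exists_point_of_subvariety {K : Type u} [Field K] (hK : AlgHP K (Polynomial K)) {X : Variety K}
    (C : Subvariety X) (hC : C.toVariety.IsRational) {U : X.carrier.Opens} (hU : IsAffineOpen U)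
    [Algebra K Γ(X.carrier, U)]
    (hKU : Spec.map (CommRingCat.ofHom (algebraMap K Γ(X.carrier, U))) = hU.fromSpec ≫ X.str)
    (g : Γ(X.carrier, U)) (hg : (Set.range C.ι ∩ X.carrier.basicOpen g).Nonempty)
    {ι : Type} [Finite ι] (φ : ι → Cover X) (hφ : ∀ i, ¬ HasRationalSectionAlong C.ι (φ i).hom) :
    ∃ a : Γ(X.carrier, U) →+* K, a.comp (algebraMap K Γ(X.carrier, U)) = RingHom.id K ∧ a g ≠ 0 ∧
      ∀ i, ∀ c : Γ((φ i).source.carrier, (φ i).hom ⁻¹ᵁ U) →+* K, c.comp ((φ i).hom.app U).hom ≠ a := by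
  obtain ⟨_, ⟨x, rfl⟩, hx⟩ := hg
  obtain ⟨W, hW, _, hWG, hWK⟩ :=
    exists_algHP_of_isRational hK hC (C.ι ⁻¹ᵁ X.carrier.basicOpen g) ⟨x, hx⟩
  have hWU : W ≤ C.ι ⁻¹ᵁ U := hWG.trans (C.ι.preimage_mono (X.carrier.basicOpen_le g))
  have := functionField_isFractionRing_of_isAffineOpen C.toVariety.carrier W hW
  let : Algebra Γ(X.carrier, U) Γ(C.toVariety.carrier, W) := (C.ι.appLE U W hWU).hom.toAlgebra
  let : Algebra K Γ(C.toVariety.carrier, W) :=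
    ((algebraMap Γ(X.carrier, U) Γ(C.toVariety.carrier, W)).comp (algebraMap K _)).toAlgebra
  have hS : AlgHP K Γ(C.toVariety.carrier, W) := by
    refine hWK ?_
    change Spec.map (CommRingCat.ofHom (algebraMap K Γ(X.carrier, U)) ≫ C.ι.appLE U W hWU) = _
    rw [Spec.map_comp, hKU, IsAffineOpen.SpecMap_appLE_fromSpec_assoc]
    rfl
  let (i : ι) : Algebra Γ(X.carrier, U) Γ((φ i).source.carrier, (φ i).hom ⁻¹ᵁ U) :=
    ((φ i).hom.app U).hom.toAlgebra
  have (i : ι) : Module.Finite Γ(X.carrier, U) Γ((φ i).source.carrier, (φ i).hom ⁻¹ᵁ U) :=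
    (φ i).isFinite.finite_app U hU
  -- a section of the pullback of a cover to `W` is a rational section along the cover
  obtain ⟨a, ha⟩ := hS.exists_forall
    (fun i ↦ Γ(C.toVariety.carrier, W) ⊗[Γ(X.carrier, U)] Γ((φ i).source.carrier, (φ i).hom ⁻¹ᵁ U))
    (fun i ↦ ⟨fun θ ↦ by
      have := (φ i).isFinite
      let θ' := (FractionRing.algEquiv Γ(C.toVariety.carrier, W)
        C.toVariety.carrier.functionField).toAlgHom.comp θ
      refine hφ i (hasRationalSectionAlong_of_ringHom C.ι (φ i).hom hU (hU.preimage (φ i).hom)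
        hW le_rfl hWU (θ'.toRingHom.comp Algebra.TensorProduct.includeRight.toRingHom) ?_)
      refine RingHom.ext fun x ↦ ?_
      rw [Scheme.Hom.appLE_eq_app]
      change θ' (1 ⊗ₜ[Γ(X.carrier, U)] algebraMap _ Γ((φ i).source.carrier, (φ i).hom ⁻¹ᵁ U) x) =
        algebraMap _ _ (algebraMap _ Γ(C.toVariety.carrier, W) x)
      rw [← θ'.commutes, Algebra.TensorProduct.algebraMap_apply, Algebra.algebraMap_self_apply,
        Algebra.algebraMap_eq_smul_one, Algebra.algebraMap_eq_smul_one, TensorProduct.smul_tmul]⟩)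
  refine ⟨a.toRingHom.comp (algebraMap _ _), ?_, ?_, fun i c hc ↦ ?_⟩
  · refine RingHom.ext fun x ↦ ?_
    exact a.commutes x
  · -- `W` is contained in the open subset `g ≠ 0`
    have : IsUnit (algebraMap Γ(X.carrier, U) Γ(C.toVariety.carrier, W) g) := by
      change IsUnit ((C.ι.appLE U W hWU).hom g)
      rw [← Scheme.Hom.map_appLE C.ι hWG (homOfLE (X.carrier.basicOpen_le g)).op]
      exact (RingedSpace.isUnit_res_basicOpen X.carrier.toRingedSpace g).map
        (C.ι.appLE (X.carrier.basicOpen g) W hWG).hom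
    exact (this.map a).ne_zero
  · let : Algebra Γ(X.carrier, U) K := (c.comp ((φ i).hom.app U).hom).toAlgebra
    let c' : Γ((φ i).source.carrier, (φ i).hom ⁻¹ᵁ U) →ₐ[Γ(X.carrier, U)] K :=
      { c with commutes' := fun _ ↦ rfl }
    let a' : Γ(C.toVariety.carrier, W) →ₐ[Γ(X.carrier, U)] K :=
      { a.toRingHom with commutes' := fun x ↦ congr($hc x).symm }
    refine ha i (Algebra.TensorProduct.productMap a' c').toRingHom (RingHom.ext fun x ↦ ?_)
    change Algebra.TensorProduct.productMap a' c' (x ⊗ₜ 1) = _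
    rw [Algebra.TensorProduct.productMap_left_apply]
    rfl

theorem id_appLE_self (X : Scheme.{u}) (U : X.Opens) (h : U ≤ 𝟙 X ⁻¹ᵁ U) :
    (𝟙 X : X ⟶ X).appLE U U h = 𝟙 _ := by
  rw [Scheme.Hom.appLE, Scheme.Hom.id_app]
  exact (Category.id_comp _).trans (X.presheaf.map_id _)

/-- If `X(K)` is thin, then up to a proper closed subset all `K`-points of an affine open subset lift to
finitely many covers of degree greater than one. -/
theorem isCovered_rationalPoints {K : Type u} [Field K] (X : Variety K) (hX : IsThin X.str Set.univ)
    {U : X.carrier.Opens} (hU : IsAffineOpen U) [Nonempty U] [Algebra K Γ(X.carrier, U)]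
    (hKU : Spec.map (CommRingCat.ofHom (algebraMap K Γ(X.carrier, U))) = hU.fromSpec ≫ X.str) :
    IsCovered X U {a | a.comp (algebraMap K Γ(X.carrier, U)) = RingHom.id K} := by
  obtain ⟨Y, f, -, hsep, hft, hqc, hpts, hfib, hsec⟩ := hX
  have : LocallyOfFiniteType f := locallyOfFiniteType_of_comp f X.str
  have : QuasiCompact f := .of_comp f X.str
  obtain ⟨s, hs, hsU⟩ := isCompact_and_isOpen_iff_finite_and_eq_biUnion_affineOpens.mp
    ⟨f.isCompact_preimage hU.isCompact, (f ⁻¹ᵁ U).isOpen⟩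
  have hVU (V : s) : V.1.1 ≤ f ⁻¹ᵁ U := fun y hy ↦ by
    have : y ∈ ((f ⁻¹ᵁ U : Y.Opens) : Set Y) := by
      rw [hsU]
      exact Set.mem_iUnion₂.mpr ⟨V.1, V.2, hy⟩
    exact this
  let (V : s) : Algebra Γ(X.carrier, U) Γ(Y, V.1.1) := (f.appLE U V.1.1 (hVU V)).hom.toAlgebra
  have := hs.to_subtype
  refine (IsCovered.iUnion (κ := s)
    (T := fun V ↦ liftablePoints K Γ(X.carrier, U) Γ(Y, V.1.1)) fun V ↦ ?_).mono fun a ha ↦ ?_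
  · have : Algebra.FiniteType Γ(X.carrier, U) Γ(Y, V.1.1) :=
      LocallyOfFiniteType.finiteType_appLE f hU V.1.2 (hVU V)
    refine isCovered_of_finiteType X hU hKU _ (fun p _ hp ↦ ?_) ⟨fun e ↦ hsec ?_⟩
    · have : Algebra.QuasiFiniteAt Γ(X.carrier, U) p := by
        refine quasiFiniteAt_appLE f hfib hU V.1.2 (hVU V) p ?_
        exact eq_bot_iff.mpr fun x hx ↦ (injective_iff_map_eq_zero _).mp hp x
          (Ideal.Quotient.eq_zero_iff_mem.mpr hx)
      exact isAlgebraic_quotient_of_quasiFiniteAt p hp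
    · refine (hasRationalSectionAlong_of_ringHom (𝟙 X.carrier) f hU V.1.2 hU (hVU V)
        (le_refl U) e.toRingHom ?_).hasRationalSection
      refine RingHom.ext fun x ↦ (e.commutes x).trans ?_
      have h : (𝟙 X.carrier : X.carrier ⟶ X.carrier).appLE U U (le_refl U) = 𝟙 _ :=
        id_appLE_self _ _ _
      change _ = X.carrier.germToFunctionField U
        ((𝟙 X.carrier : X.carrier ⟶ X.carrier).appLE U U (le_refl U) x)
      rw [h]
      rfl
  · let x : RationalPoints X.str := ⟨Spec.map (CommRingCat.ofHom a) ≫ hU.fromSpec, by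
      rw [Category.assoc, ← hKU, ← Spec.map_comp, ← CommRingCat.ofHom_comp, ha]
      exact Spec.map_id _⟩
    obtain ⟨⟨y, hy'⟩, hy⟩ := hpts (Set.mem_univ x)
    replace hy : y ≫ f = Spec.map (CommRingCat.ofHom a) ≫ hU.fromSpec := congr($hy.1)
    let pt : Spec (.of K) := (⊥ : PrimeSpectrum K)
    have hpt : y pt ∈ ((f ⁻¹ᵁ U : Y.Opens) : Set Y) := by
      change f (y pt) ∈ U
      rw [← Scheme.Hom.comp_apply, hy, Scheme.Hom.comp_apply]
      have : hU.fromSpec (Spec.map (CommRingCat.ofHom a) pt) ∈ Set.range hU.fromSpec := ⟨_, rfl⟩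
      rwa [hU.range_fromSpec] at this
    rw [hsU] at hpt
    obtain ⟨V, hV, hyV⟩ := Set.mem_iUnion₂.mp hpt
    have hVa : IsAffineOpen V.1 := V.2
    have hr : Set.range y ⊆ Set.range hVa.fromSpec := by
      rw [hVa.range_fromSpec]
      rintro _ ⟨z, rfl⟩
      rwa [Subsingleton.elim (α := PrimeSpectrum K) z pt]
    let l := IsOpenImmersion.lift hVa.fromSpec y hr
    have hl : l ≫ hVa.fromSpec = y := IsOpenImmersion.lift_fac _ _ _
    refine Set.mem_iUnion.mpr ⟨⟨V, hV⟩, ha, (Spec.preimage l).hom, ?_⟩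
    have : f.appLE U V (hVU ⟨V, hV⟩) ≫ Spec.preimage l = CommRingCat.ofHom a := by
      refine Spec.map_injective ?_
      rw [← cancel_mono hU.fromSpec, Spec.map_comp, Spec.map_preimage, Category.assoc,
        IsAffineOpen.SpecMap_appLE_fromSpec f hU hVa, reassoc_of% hl, hy]
    exact congr($(this).hom)

/-! ### Hilbertian fields -/

open Limits

section ReducedSubscheme

open Scheme.IdealSheafData

/-- A morphism from a reduced scheme to `X` with image in a closed subset `Z` factors through the reduced
subscheme structure on `Z`. -/
theorem vanishingIdeal_le_ker {T X : Scheme.{u}} [IsReduced T] (t : T ⟶ X) [QuasiCompact t]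
    (Z : TopologicalSpace.Closeds X) (ht : Set.range t ⊆ Z) : vanishingIdeal Z ≤ t.ker := by
  have h : vanishingIdeal Z ≤ t.ker.radical := by
    rw [← vanishingIdeal_support]
    refine vanishingIdeal_antimono ?_
    intro x hx
    have hx' : x ∈ (t.ker.support : Set X) := hx
    rw [Scheme.Hom.support_ker] at hx'
    exact closure_minimal ht Z.isClosed hx'
  intro U
  refine (h U).trans ?_
  change (t.ker.ideal U).radical ≤ _
  rw [Scheme.Hom.ker_apply]
  exact (Ideal.isRadical_bot.comap (t.app U).hom).radical.le

theorem isReduced_subscheme_vanishingIdeal {X : Scheme.{u}} (Z : TopologicalSpace.Closeds X) :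
    IsReduced (vanishingIdeal Z).subscheme := by
  have (U : X.affineOpens) : AlgebraicGeometry.IsReduced ((vanishingIdeal Z).subschemeCover.openCover.X U) := by
    have : _root_.IsReduced (Γ(X, U) ⧸ (vanishingIdeal Z).ideal U) := by
      rw [← Ideal.isRadical_iff_quotient_reduced, vanishingIdeal_ideal]
      exact PrimeSpectrum.isRadical_vanishingIdeal _
    exact inferInstanceAs (IsReduced (Spec (.of (Γ(X, U) ⧸ (vanishingIdeal Z).ideal U))))
  exact @IsReduced.of_openCover _ (vanishingIdeal Z).subschemeCover.openCover this

end ReducedSubscheme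

/-- If `j : Spec R ⟶ X` is a chart and `z : Z ⟶ X` misses it, then lifting a point of the chart to
`Spec B ⨿ Z` means lifting it to `B`. -/
theorem exists_comp_algebraMap_eq {R B F : Type u} [CommRing R] [CommRing B] [Algebra R B] [Field F]
    {X Z : Scheme.{u}} (j : Spec (.of R) ⟶ X) [IsOpenImmersion j] (z : Z ⟶ X)
    (hz : Disjoint (Set.range z) (Set.range j)) (r : R →+* F)
    (y : Spec (.of F) ⟶ Spec (.of B) ⨿ Z)
    (hy : y ≫ coprod.desc (Spec.map (CommRingCat.ofHom (algebraMap R B)) ≫ j) z =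
      Spec.map (CommRingCat.ofHom r) ≫ j) :
    ∃ b : B →+* F, b.comp (algebraMap R B) = r := by
  have hr : Set.range y ⊆ Set.range (coprod.inl : Spec (.of B) ⟶ Spec (.of B) ⨿ Z) := by
    rintro _ ⟨p, rfl⟩
    obtain ⟨x | x, hx⟩ := (coprodMk (Spec (.of B)) Z).surjective (y p)
    · exact ⟨x, by rw [← hx, coprodMk_inl]⟩
    · rw [coprodMk_inr] at hx
      refine (Set.disjoint_left.mp hz ⟨x, rfl⟩ ⟨Spec.map (CommRingCat.ofHom r) p, ?_⟩).elim
      rw [← Scheme.Hom.comp_apply, ← hy, Scheme.Hom.comp_apply, ← hx, ← Scheme.Hom.comp_apply,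
        coprod.inr_desc]
  let l := IsOpenImmersion.lift coprod.inl y hr
  have hl : l ≫ coprod.inl = y := IsOpenImmersion.lift_fac _ _ _
  refine ⟨(Spec.preimage l).hom, ?_⟩
  have : CommRingCat.ofHom (algebraMap R B) ≫ Spec.preimage l = CommRingCat.ofHom r := by
    refine Spec.map_injective ?_
    rw [← cancel_mono j, ← hy, ← hl, Category.assoc, coprod.inl_desc, Spec.map_comp,
      Spec.map_preimage, Category.assoc]
  exact congr($(this).hom)

variable {K : Type u} [Field K]

/-- An affine open subset `Spec R` of a scheme with the Hilbert property has the Hilbert property: if all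
its `K`-points lift to a finite `R`-algebra `B`, then all `K`-points of the scheme lift to the disjoint
union of `Spec B_red` and the reduced complement of `Spec R`. -/
theorem AlgHP.of_hasHilbertProperty {X : Scheme.{u}} (s : X ⟶ Spec (.of K)) [IsSeparated s]
    [LocallyOfFiniteType s] [QuasiCompact s] {R : Type u} [CommRing R] [IsDomain R] [Algebra K R]
    (j : Spec (.of R) ⟶ X) [IsOpenImmersion j]
    (hj : j ≫ s = Spec.map (CommRingCat.ofHom (algebraMap K R))) (h : HasHilbertProperty s) :
    AlgHP K R := by
  intro B₀ _ _ _ hB₀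
  by_contra! hpts
  let B := B₀ ⧸ nilradical B₀
  have hB : IsEmpty (B →ₐ[R] FractionRing R) :=
    ⟨fun θ ↦ hB₀.false (θ.comp (Ideal.Quotient.mkₐ R (nilradical B₀)))⟩
  have : _root_.IsReduced B := (Ideal.isRadical_iff_quotient_reduced _).mp (Ideal.radical_isRadical _)
  refine h ?_
  let Zc : TopologicalSpace.Closeds X := ⟨(Set.range j)ᶜ, j.isOpenEmbedding.isOpen_range.isClosed_compl⟩
  let I := Scheme.IdealSheafData.vanishingIdeal Zc
  have : IsReduced I.subscheme := isReduced_subscheme_vanishingIdeal Zc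
  have hI : Set.range I.subschemeι = (Set.range j)ᶜ := by
    rw [Scheme.IdealSheafData.range_subschemeι, Scheme.IdealSheafData.coe_support_vanishingIdeal]
    rfl
  let a : Spec (.of B) ⟶ X := Spec.map (CommRingCat.ofHom (algebraMap R B)) ≫ j
  let f : Spec (.of B) ⨿ I.subscheme ⟶ X := coprod.desc a I.subschemeι
  have : IsAffineHom (j ≫ s) := by rw [hj]; infer_instance
  have : IsAffineHom j := .of_comp j s
  have : IsFinite (Spec.map (CommRingCat.ofHom (algebraMap R B))) := by
    rw [IsFinite.SpecMap_iff]
    exact RingHom.finite_algebraMap.mpr inferInstance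
  have : IsAffineHom f := inferInstance
  have hcov (P : MorphismProperty Scheme.{u}) {Q} [HasRingHomProperty P Q] (h1 : P a)
      (h2 : P I.subschemeι) : P f := by
    refine (IsZariskiLocalAtSource.iff_of_openCover (P := P) (coprodOpenCover.{u, 0} _ _)).mpr ?_
    rintro (_ | _)
    · change P (coprod.inl ≫ f)
      rwa [coprod.inl_desc]
    · change P (coprod.inr ≫ f)
      rwa [coprod.inr_desc]
  have : LocallyQuasiFinite f := hcov @LocallyQuasiFinite inferInstance inferInstance
  have : LocallyOfFiniteType f := hcov @LocallyOfFiniteType inferInstance inferInstance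
  have : IsReduced (Spec (.of B) ⨿ I.subscheme) := by
    have (i : _) : AlgebraicGeometry.IsReduced ((coprodOpenCover.{u, 0} (Spec (.of B)) I.subscheme).X i) := by
      obtain (_ | _) := i
      · exact inferInstanceAs (IsReduced (Spec (.of B)))
      · exact inferInstanceAs (IsReduced I.subscheme)
    exact @IsReduced.of_openCover _ (coprodOpenCover.{u, 0} _ _) this
  refine ⟨_, f, this, inferInstance, inferInstance, inferInstance, ?_, fun _ _ ↦ inferInstance, ?_⟩
  -- a `K`-point lies in the chart or in its complement
  · rintro ⟨x, hx⟩ -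
    by_cases hxj : Set.range x ⊆ Set.range j
    · let l := IsOpenImmersion.lift j x hxj
      have hl : l ≫ j = x := IsOpenImmersion.lift_fac _ _ _
      let r : R →ₐ[K] K := { (Spec.preimage l).hom with
        commutes' := fun c ↦ by
          have : CommRingCat.ofHom (algebraMap K R) ≫ Spec.preimage l = 𝟙 _ := by
            refine Spec.map_injective ?_
            rw [Spec.map_comp, Spec.map_preimage, ← hj, reassoc_of% hl, hx, Spec.map_id]
          exact congr($this c) }
      obtain ⟨b, hb⟩ := hpts r
      have hb0 : ∀ x ∈ nilradical B₀, b x = 0 := fun x hx ↦ ((mem_nilradical.mp hx).map b).eq_zero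
      let b' : B →+* K := Ideal.Quotient.lift _ b hb0
      have hy : (Spec.map (CommRingCat.ofHom b') ≫ coprod.inl) ≫ f = x := by
        rw [Category.assoc, coprod.inl_desc, ← hl, ← Spec.map_comp_assoc]
        congr 1
        rw [← Spec.map_preimage l]
        congr 1
        exact CommRingCat.hom_ext hb
      refine ⟨⟨Spec.map (CommRingCat.ofHom b') ≫ coprod.inl, ?_⟩, Subtype.ext hy⟩
      rw [← Category.assoc, hy, hx]
    · have hxZ : Set.range x ⊆ Zc := by
        obtain ⟨_, ⟨p, rfl⟩, hp⟩ := Set.not_subset.mp hxj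
        rintro _ ⟨q, rfl⟩
        rwa [Subsingleton.elim (α := PrimeSpectrum K) q p]
      have hker : I.subschemeι.ker ≤ x.ker := by
        rw [Scheme.IdealSheafData.ker_subschemeι]
        exact vanishingIdeal_le_ker x Zc hxZ
      have hy : (IsClosedImmersion.lift I.subschemeι x hker ≫ coprod.inr) ≫ f = x := by
        rw [Category.assoc, coprod.inr_desc, IsClosedImmersion.lift_fac]
      refine ⟨⟨IsClosedImmersion.lift I.subschemeι x hker ≫ coprod.inr, ?_⟩, Subtype.ext hy⟩
      rw [← Category.assoc, hy, hx]
  -- a rational section is defined at the generic point of the chart, where it has values in `Spec B`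
  · rintro ⟨ψ, hψ⟩
    let L := FractionRing R
    let t : Spec (.of L) ⟶ X := Spec.map (CommRingCat.ofHom (algebraMap R L)) ≫ j
    have ht : Set.range t ⊆ Set.range ψ.domain.ι := by
      obtain ⟨_, hp, p, rfl⟩ := ψ.dense_domain.inter_open_nonempty _ j.opensRange.isOpen
        ⟨_, Set.mem_range_self (f := j) (⊥ : PrimeSpectrum R)⟩ |>.imp fun _ ↦ And.symm
      rw [Scheme.Opens.range_ι]
      rintro _ ⟨q, rfl⟩
      let g : Spec (.of R) := Spec.map (CommRingCat.ofHom (algebraMap R L)) q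
      have hg : (show PrimeSpectrum R from g) = ⊥ := by
        refine PrimeSpectrum.ext ?_
        have : q = (⊥ : PrimeSpectrum L) := Subsingleton.elim (α := PrimeSpectrum L) _ _
        subst this
        exact Ideal.comap_bot_of_injective _ (IsFractionRing.injective R L)
      have hgp : g ⤳ p := (PrimeSpectrum.le_iff_specializes (R := R) g p).mp (by rw [hg]; exact bot_le)
      exact hgp.mem_open (j ⁻¹ᵁ ψ.domain).isOpen hp
    let l := IsOpenImmersion.lift ψ.domain.ι t ht
    have hl : l ≫ ψ.domain.ι = t := IsOpenImmersion.lift_fac _ _ _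
    obtain ⟨b, hb⟩ := exists_comp_algebraMap_eq (B := B) j I.subschemeι (by
      rw [hI]; exact disjoint_compl_left) (algebraMap R L) (l ≫ ψ.hom) (by
      rw [Category.assoc]
      refine (congr(l ≫ $hψ)).trans hl)
    exact hB.false { b with commutes' := fun c ↦ congr($hb c) }

section ProjectiveSpace

attribute [local instance] MvPolynomial.gradedAlgebra

variable (n : ℕ) (K : Type u) [Field K]

theorem algebraMap_homogeneousSubmodule_zero_surjective : Function.Surjective
    (algebraMap K (MvPolynomial.homogeneousSubmodule (Fin (n + 1)) K 0)) := fun p ↦ by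
  obtain ⟨c, hc⟩ : ∃ c, p.1 = MvPolynomial.C c :=
    ⟨_, MvPolynomial.totalDegree_eq_zero_iff_eq_C.mp
      (Nat.le_zero.mp (MvPolynomial.IsHomogeneous.totalDegree_le p.2))⟩
  exact ⟨c, Subtype.ext hc.symm⟩

instance : IsScalarTower K (MvPolynomial.homogeneousSubmodule (Fin (n + 1)) K 0)
    (MvPolynomial (Fin (n + 1)) K) :=
  IsScalarTower.of_algebraMap_eq (R := K)
    (S := MvPolynomial.homogeneousSubmodule (Fin (n + 1)) K 0) fun _ ↦ rfl

instance : Algebra.FiniteType (MvPolynomial.homogeneousSubmodule (Fin (n + 1)) K 0)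
    (MvPolynomial (Fin (n + 1)) K) :=
  .of_restrictScalars_finiteType K _ _

instance : IsClosedImmersion (Spec.map (CommRingCat.ofHom
    (algebraMap K (MvPolynomial.homogeneousSubmodule (Fin (n + 1)) K 0)))) :=
  IsClosedImmersion.spec_of_surjective _ (algebraMap_homogeneousSubmodule_zero_surjective n K)

instance : IsSeparated (projectiveSpaceStr n K) :=
  inferInstanceAs (IsSeparated (Proj.toSpecZero _ ≫ Spec.map _))

instance : LocallyOfFiniteType (projectiveSpaceStr n K) :=
  inferInstanceAs (LocallyOfFiniteType (Proj.toSpecZero _ ≫ Spec.map _))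

instance : QuasiCompact (projectiveSpaceStr n K) :=
  inferInstanceAs (QuasiCompact (Proj.toSpecZero _ ≫ Spec.map _))

end ProjectiveSpace

theorem algHP_polynomial (hK : IsHilbertian K) : AlgHP K (Polynomial K) :=
  (AlgHP.of_hasHilbertProperty (projectiveSpaceStr 1 K) (chart 1 K) (chart_str 1 K) hK).of_algEquiv
    (MvPolynomial.uniqueAlgEquiv K (Fin 1))

end HilbertProperty

end

theorem proposition4p1 {K : Type u} [Field K] (hK : HilbertProperty.IsHilbertian K)
    (X : HilbertProperty.Variety K) (hX : X.IsQuasiProjective)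
    (𝒞 : Set (HilbertProperty.Subvariety X)) (h𝒞 : 𝒞.Infinite)
    (hrat : ∀ C ∈ 𝒞, C.toVariety.IsRational)
    (hcov : ∀ (r : ℕ) (φ : Fin r → HilbertProperty.Cover X), (∀ i, 1 < (φ i).degree) →
      ∃ 𝒞' ⊆ 𝒞, Dense (⋃ C ∈ 𝒞', Set.range C.ι) ∧
        ∀ C ∈ 𝒞', ∀ i, ¬ HilbertProperty.HasRationalSectionAlong C.ι (φ i).hom) :
    HilbertProperty.HasHilbertProperty X.str := by
  have hK' := HilbertProperty.algHP_polynomial hK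
  intro hthin
  obtain ⟨U, hU, hηU⟩ := HilbertProperty.exists_isAffineOpen_mem (genericPoint X.carrier)
  have : Nonempty U := ⟨⟨_, hηU⟩⟩
  let : Algebra K Γ(X.carrier, U) := (Spec.preimage (hU.fromSpec ≫ X.str)).hom.toAlgebra
  have hKU : Spec.map (CommRingCat.ofHom (algebraMap K Γ(X.carrier, U))) = hU.fromSpec ≫ X.str :=
    Spec.map_preimage _
  obtain ⟨g, hg, ι, _, φ, hφ, h⟩ := HilbertProperty.isCovered_rationalPoints X hthin hU hKU
  obtain ⟨r, ⟨e⟩⟩ := Finite.exists_equiv_fin ι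
  obtain ⟨𝒞', h𝒞', hd, hs⟩ := hcov r (φ ∘ e.symm) fun i ↦ hφ _
  obtain ⟨x, hxg, hx⟩ := hd.inter_open_nonempty (X.carrier.basicOpen g) (X.carrier.basicOpen g).isOpen (by
    rw [← TopologicalSpace.Opens.ne_bot_iff_nonempty]
    exact fun h ↦ hg ((basicOpen_eq_bot_iff _).mp h))
  obtain ⟨C, hC, hxC⟩ := Set.mem_iUnion₂.mp hx
  obtain ⟨a, haK, hag, ha⟩ := HilbertProperty.exists_point_of_subvariety hK' C (hrat C (h𝒞' hC)) hU hKU g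
    ⟨x, hxC, hxg⟩ φ fun i hi ↦ hs C hC (e i) (by rwa [Function.comp_apply, e.symm_apply_apply])
  obtain ⟨i, c, hc⟩ := h a haK hag
  exact ha i c hc
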